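/- For a positive integer $n$, an arithmetic progression in $\mathbb{Z}_n=\mathbb{Z}/n\mathbb{Z}$ is a set of the form $\{a+kd : 0\le k<l\}$ with $a,d\in\mathbb{Z}_n$ and an integer $l\ge 0$. Let $\mathcal{A}_n$ be the family of all arithmetic progressions in $\mathbb{Z}_n$, and let $$\operatorname{disc}(\mathcal{A}_n)=\min_{\chi:\mathbb{Z}_n\to\{1,-1\}}\ \max_{A\in\mathcal{A}_n}\Big|\sum_{x\in A}\chi(x)\Big|.$$ **Theorem 1.2 (prime power).** If $n=p^k$ for a prime $p$ and a positive integer $k$, then $$\operatorname{disc}(\mathcal{A}_n)=\Theta\left(p^{\frac{k-\lfloor k/3\rfloor}{2}}\right)=\Theta\left(n^{\frac13+\frac{r_k}{6k}}\right),$$ where $r_k\in\{0,1,2\}$ is the remainder when $k$ is divided by $3$ and the implied constants are absolute (independent of $p$ and $k$). The constant in the lower bounds can be taken to be $1/4$; that is, there is an absolute constant $C>0$ such that for every prime $p$ and every positive integer $k$, with $n=p^k$, $$\tfrac14\,p^{\frac{k-\lfloor k/3\rfloor}{2}}\le \operatorname{disc}(\mathcal{A}_n)\le C\,p^{\frac{k-\lfloor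 k/3\rfloor}{2}}\quad\text{and}\quad \tfrac14\,n^{\frac13+\frac{r_k}{6k}}\le \operatorname{disc}(\mathcal{A}_n)\le C\,n^{\frac13+\frac{r_k}{6k}}.$$ -/

import Mathlib

/-- `χ(A) = ∑_{x ∈ A} χ(x)` for a two-colouring `χ : Ω → {1, -1}`. The values `1, -1` are
represented by the units of `ℤ`. -/
def colorSum {Ω : Type*} (χ : Ω → ℤˣ) (A : Finset Ω) : ℤ :=
  ∑ x ∈ A, (χ x : ℤ)

/-- `max_{A ∈ 𝒜} |χ(A)|` for a finite family `𝒜` of finite subsets of `Ω`. -/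
def maxImbalance {Ω : Type*} (𝒜 : Finset (Finset Ω)) (χ : Ω → ℤˣ) : ℕ :=
  𝒜.sup fun A => (colorSum χ A).natAbs

/-- The discrepancy `disc(𝒜) = min_χ max_{A ∈ 𝒜} |χ(A)|`, the minimum being over all two-colourings
`χ : Ω → {1, -1}`. -/
noncomputable def disc {Ω : Type*} (𝒜 : Finset (Finset Ω)) : ℕ :=
  ⨅ χ : Ω → ℤˣ, maxImbalance 𝒜 χ

open Classical in
/-- The family of all arithmetic progressions `{a + k d : 0 ≤ k < l}` in `ℤ/nℤ`, for
`a, d ∈ ℤ/nℤ` and `l ≥ 0`, as sets (so repeated elements count once). -/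
noncomputable def modularAP (n : ℕ) [NeZero n] : Finset (Finset (ZMod n)) :=
  Finset.univ.filter fun A =>
    ∃ (a d : ZMod n) (l : ℕ), A = (Finset.range l).image fun k : ℕ => a + (k : ZMod n) * d

/-- The minimum in the definition of the discrepancy is attained. -/
theorem exists_maxImbalance_eq_disc {Ω : Type*} (𝒜 : Finset (Finset Ω)) :
    ∃ χ : Ω → ℤˣ, maxImbalance 𝒜 χ = disc 𝒜 :=
  Nat.sInf_mem (Set.range_nonempty fun χ : Ω → ℤˣ => maxImbalance 𝒜 χ)

/-! Lower bound. Let f be a colouring whose progression sums are at most D in absolute value. With m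
= ⌊k/3⌋ and e = k - m - 1, let P average f over the cosets of the subgroup generated by p^e, which
has order L = p^(m+1), and put g = f - P. Cosets are progressions, so |P| ≤ D/L and g keeps at least
the fraction 1 - D²/L² of the square mass. Take progressions of length l = ⌊p/2⌋p^e and average the
squared sums of g over all starts and all unit differences d. The off-diagonal terms are
autocorrelations of g at h·d with 0 < |h| < l, summed over units d. As g sums to zero on cosets,
these sums vanish unless p^e ∣ h, and then they cost at most p^(k-1) times the mass
(`sum_isUnit_autocorr_ge`). The part P is orthogonal to g and can only increase the second moment.
Hence D² ≳ (1 - D²/L²) p^(k-m), and L² ≥ p^(k-m) finishes.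

Upper bound. With K = k - m, colour ℤ/p^K and pull back along reduction. A progression without
repetition then winds at most p^m ≤ √(p^K) times around an orbit, so it suffices that full orbits
have sum O(1) and partial ones O(√(p^K)). Digit reversal turns every coset of every subgroup into an
interval; giving opposite signs to neighbours 2v, 2v+1 balances all intervals up to 2
(`abs_sum_orbit_le`). One sign per pair stays free. Lay out the orbits of each difference as a
linear order and choose the signs so that all prefixes of these p^K orders are small, by iterated
partial colouring on dyadic blocks (`exists_partial_coloring`, `exists_coloring_orders_on`). -/

section

open Finset

/-! ### Coset averages and autocorrelation -/

section CosetAverage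

variable {n : ℕ}

theorem sum_range_add_nsmul_periodic {L : ℕ} {q : ZMod n} (hL : (L : ZMod n) * q = 0)
    (f : ZMod n → ℝ) (x : ZMod n) (r : ℕ) :
    ∑ s ∈ range L, f (x + r * q + s * q) = ∑ s ∈ range L, f (x + s * q) := by
  induction r with
  | zero => simp
  | succ r ih =>
    rw [← ih]
    have h1 := sum_range_succ (fun s : ℕ => f (x + r * q + s * q)) L
    have h2 := sum_range_succ' (fun s : ℕ => f (x + r * q + s * q)) L
    rw [h1] at h2
    simp only [hL, Nat.cast_zero, zero_mul, add_zero, add_left_inj] at h2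
    rw [h2]
    refine sum_congr rfl fun s _ => ?_
    congr 1
    push_cast
    ring

/-- Translating `T` by `y` shifts the argument of `g` by `q`, so the sum equals its average over `L`
such shifts, which is zero by `hg`. -/
theorem sum_mul_dilate_eq_zero {L : ℕ} (hL0 : L ≠ 0) {q h y : ZMod n} {g : ZMod n → ℝ}
    (hg : ∀ x, ∑ s ∈ range L, g (x + s * q) = 0) (hy : h * y = q) {T : Finset (ZMod n)}
    (hT : ∀ d, d + y ∈ T ↔ d ∈ T) (b : ZMod n) : ∑ d ∈ T, g (b + h * d) = 0 := by
  have hT' : ∀ (s : ℕ) (d), d + s * y ∈ T ↔ d ∈ T := by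
    intro s
    induction s with
    | zero => simp
    | succ s ih =>
      intro d
      rw [← ih d, ← hT (d + s * y)]
      push_cast
      ring_nf
  have key : ∀ s ∈ range L, ∑ d ∈ T, g (b + h * d) = ∑ d ∈ T, g (b + h * d + s * q) := by
    intro s _
    symm
    refine sum_bij (fun d _ => d + s * y) (fun d hd => (hT' s d).2 hd)
      (fun _ _ _ _ h => by simpa using h) (fun d hd => ⟨d - s * y, ?_, by ring⟩) ?_
    · rw [← hT' s]; simpa using hd
    · intro d _
      congr 1
      rw [← hy]; ring
  have h2 : ∑ s ∈ range L, ∑ d ∈ T, g (b + h * d) = 0 := by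
    rw [sum_congr rfl key, sum_comm]
    exact sum_eq_zero fun d _ => hg _
  rw [sum_const, card_range, nsmul_eq_mul] at h2
  exact (mul_eq_zero.1 h2).resolve_left (by exact_mod_cast hL0)

variable [NeZero n]

theorem sum_periodic_mul_eq_zero {L : ℕ} (hL0 : L ≠ 0) {q : ZMod n} {P g : ZMod n → ℝ}
    (hP : ∀ (s : ℕ) x, P (x + s * q) = P x)
    (hg : ∀ x, ∑ s ∈ range L, g (x + s * q) = 0) (z : ZMod n) :
    ∑ b, P b * g (b + z) = 0 := by
  have key : ∀ s ∈ range L, ∑ b, P b * g (b + z) = ∑ b, P b * g (b + z + s * q) := by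
    intro s _
    rw [← Equiv.sum_comp (Equiv.addRight ((s : ZMod n) * q))]
    refine sum_congr rfl fun b _ => ?_
    simp only [Equiv.coe_addRight, hP]
    congr 2
    ring
  have h2 : ∑ s ∈ range L, ∑ b, P b * g (b + z) = 0 := by
    rw [sum_congr rfl key, sum_comm]
    refine sum_eq_zero fun d _ => ?_
    rw [← mul_sum, hg, mul_zero]
  rw [sum_const, card_range, nsmul_eq_mul] at h2
  exact (mul_eq_zero.1 h2).resolve_left (by exact_mod_cast hL0)

/-- The autocorrelation of a real function on `ℤ/nℤ`. -/
def autocorr (g : ZMod n → ℝ) (z : ZMod n) : ℝ := ∑ b, g b * g (b + z)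

theorem autocorr_zero_nonneg (g : ZMod n → ℝ) : 0 ≤ autocorr g 0 :=
  sum_nonneg fun b _ => by simpa using mul_self_nonneg (g b)

theorem autocorr_le (g : ZMod n → ℝ) (z : ZMod n) : autocorr g z ≤ autocorr g 0 := by
  have h : ∑ b, g (b + z) * g (b + z) = ∑ b, g b * g b :=
    Equiv.sum_comp (Equiv.addRight z) fun b => g b * g b
  have h2 : ∑ b, g b * g (b + z) ≤ ∑ b, (g b * g b + g (b + z) * g (b + z)) / 2 :=
    sum_le_sum fun b _ => by nlinarith [sq_nonneg (g b - g (b + z))]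
  rw [← sum_div, sum_add_distrib, h] at h2
  simp only [autocorr, add_zero]
  linarith

theorem sum_sq_sum_range (g : ZMod n → ℝ) (l : ℕ) (d : ZMod n) :
    ∑ a, (∑ s ∈ range l, g (a + s * d)) ^ 2 =
      ∑ s ∈ range l, ∑ t ∈ range l, autocorr g (((t : ℤ) - (s : ℤ) : ℤ) * d) := by
  simp only [sq, sum_mul_sum]
  rw [sum_comm]
  refine sum_congr rfl fun s _ => ?_
  rw [sum_comm]
  refine sum_congr rfl fun t _ => ?_
  rw [autocorr]
  symm
  rw [← Equiv.sum_comp (Equiv.addRight ((s : ZMod n) * d))]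
  refine sum_congr rfl fun b _ => ?_
  simp only [Equiv.coe_addRight]
  congr 2
  push_cast
  ring

end CosetAverage

/-! ### Unit dilates modulo a prime power -/

section PrimePower

variable {p k : ℕ}

/-- The gcd of `h` and `p ^ k` is `p ^ i` with `i ≤ e`; Bézout provides `y`. -/
theorem exists_intCast_mul_eq_pow (hp : p.Prime) {e : ℕ} {h : ℤ}
    (hh : ¬ ((p : ℤ) ^ (e + 1)) ∣ h) :
    ∃ y : ZMod (p ^ k), (h : ZMod (p ^ k)) * y = (p : ZMod (p ^ k)) ^ e := by
  obtain ⟨i, _, hi⟩ := (Nat.dvd_prime_pow hp).1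
    (Int.natCast_dvd_natCast.1 (Int.gcd_dvd_right h ((p ^ k : ℕ) : ℤ)))
  have hie : i ≤ e := by
    by_contra hlt
    refine hh ((pow_dvd_pow _ (by omega)).trans (?_ : (p : ℤ) ^ i ∣ h))
    have := Int.gcd_dvd_left h ((p ^ k : ℕ) : ℤ)
    rw [hi] at this
    exact_mod_cast this
  have hb := Int.gcd_eq_gcd_ab h ((p ^ k : ℕ) : ℤ)
  rw [hi] at hb
  have hb' := congrArg (Int.cast : ℤ → ZMod (p ^ k)) hb
  push_cast at hb'
  have hz : (p : ZMod (p ^ k)) ^ k = 0 := by exact_mod_cast ZMod.natCast_self (p ^ k)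
  rw [hz, zero_mul, add_zero] at hb'
  refine ⟨(Int.gcdA h ((p ^ k : ℕ) : ℤ) : ZMod (p ^ k)) * (p : ZMod (p ^ k)) ^ (e - i), ?_⟩
  rw [← mul_assoc]
  push_cast
  rw [← hb', ← pow_add, Nat.add_sub_cancel' hie]

theorem isUnit_add_prime_mul_iff (y d : ZMod (p ^ k)) :
    IsUnit (d + p * y) ↔ IsUnit d := by
  have hn : IsNilpotent ((p : ZMod (p ^ k)) * y) :=
    ⟨k, by rw [mul_pow]; rw [show (p : ZMod (p ^ k)) ^ k = 0 by
      exact_mod_cast ZMod.natCast_self (p ^ k), zero_mul]⟩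
  constructor
  · intro h
    have := hn.neg.isUnit_add_left_of_commute h (Commute.all _ _)
    simpa using this
  · intro h
    exact hn.isUnit_add_left_of_commute h (Commute.all _ _)

theorem card_filter_not_isUnit (hp : p.Prime) (hk : 0 < k) [NeZero (p ^ k)] :
    #{d : ZMod (p ^ k) | ¬ IsUnit d} = p ^ (k - 1) := by
  classical
  have h1 : #{d : ZMod (p ^ k) | IsUnit d} = p ^ (k - 1) * (p - 1) := by
    rw [← Nat.totient_prime_pow hp hk, ← ZMod.card_units_eq_totient, ← Finset.card_univ]
    symm
    refine card_bij (fun u _ => (u : ZMod (p ^ k))) (by simp) (by simp [Units.ext_iff]) ?_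
    intro b hb
    obtain ⟨u, rfl⟩ := (mem_filter.1 hb).2
    exact ⟨u, by simp⟩
  have h2 := card_filter_add_card_filter_not (s := (univ : Finset (ZMod (p ^ k)))) (fun d => IsUnit d)
  rw [h1, card_univ, ZMod.card] at h2
  obtain ⟨j, rfl⟩ := Nat.exists_eq_succ_of_ne_zero hk.ne'
  obtain ⟨r, rfl⟩ := Nat.exists_eq_succ_of_ne_zero hp.ne_zero
  simp only [Nat.succ_eq_add_one, Nat.add_sub_cancel, pow_succ] at *
  linarith

/-- If `p ^ e ∤ h`, some `y` has `h * p * y = p ^ e`, and the units are stable under translation by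
`p * y`, so the sum vanishes. If `p ^ e ∣ h` and `h ≠ 0`, only the sum over all `d` vanishes, and
the `p ^ (k - 1)` non-units are removed at the price of `autocorr g 0` each. -/
theorem sum_isUnit_autocorr_ge (hp : p.Prime) (hk : 0 < k) [NeZero (p ^ k)] {L e : ℕ}
    (hL0 : L ≠ 0) {g : ZMod (p ^ k) → ℝ}
    (hg : ∀ x, ∑ s ∈ range L, g (x + s * (p : ZMod (p ^ k)) ^ e) = 0) {h : ℤ}
    (hh : h = 0 ∨ ¬ ((p : ℤ) ^ (e + 1)) ∣ h) :
    autocorr g 0 * ((if h = 0 then (p : ℝ) ^ k else 0) -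
        (if (p : ℤ) ^ e ∣ h then (p : ℝ) ^ (k - 1) else 0)) ≤
      ∑ d : ZMod (p ^ k) with IsUnit d, autocorr g (h * d) := by
  classical
  have swap : ∀ T : Finset (ZMod (p ^ k)), (∀ b, ∑ d ∈ T, g (b + h * d) = 0) →
      ∑ d ∈ T, autocorr g (h * d) = 0 := by
    intro T hT
    simp only [autocorr]
    rw [sum_comm]
    refine sum_eq_zero fun b _ => ?_
    rw [← mul_sum, hT, mul_zero]
  by_cases hq : (p : ℤ) ^ e ∣ h
  · have hsplit := sum_filter_add_sum_filter_not (univ : Finset (ZMod (p ^ k)))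
      (fun d => IsUnit d) (fun d => autocorr g (h * d))
    have hnon : ∑ d : ZMod (p ^ k) with ¬ IsUnit d, autocorr g (h * d) ≤
        autocorr g 0 * (p : ℝ) ^ (k - 1) := by
      refine (sum_le_card_nsmul _ _ _ fun d _ => autocorr_le g _).trans ?_
      rw [card_filter_not_isUnit hp hk, nsmul_eq_mul, mul_comm]
      push_cast
      rfl
    have hall : autocorr g 0 * (if h = 0 then (p : ℝ) ^ k else 0) =
        ∑ d : ZMod (p ^ k), autocorr g (h * d) := by
      rcases hh with rfl | hh
      · simp [ZMod.card, mul_comm]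
      · rw [if_neg (by rintro rfl; simp at hh), mul_zero]
        obtain ⟨y, hy⟩ := exists_intCast_mul_eq_pow (k := k) hp hh
        exact (swap _ (sum_mul_dilate_eq_zero hL0 hg hy (by simp))).symm
    rw [if_pos hq, mul_sub, hall]
    linarith
  · rw [if_neg hq, if_neg (by rintro rfl; simp at hq)]
    have hh' : ¬ ((p : ℤ) ^ (e + 1)) ∣ h * p := by
      rw [pow_succ]
      intro hc
      exact hq (Int.dvd_of_mul_dvd_mul_right (by exact_mod_cast hp.ne_zero) hc)
    obtain ⟨y, hy⟩ := exists_intCast_mul_eq_pow (k := k) hp hh'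
    rw [swap]
    · simp
    · refine sum_mul_dilate_eq_zero hL0 hg (y := (p : ZMod (p ^ k)) * y) ?_ ?_
      · rw [← hy]; push_cast; ring
      · intro d; simp [isUnit_add_prime_mul_iff]

end PrimePower

/-! ### Lower bound by a second moment -/

theorem natCast_natAbs_colorSum_eq {Ω : Type*} (χ : Ω → ℤˣ) (A : Finset Ω) :
    ((colorSum χ A).natAbs : ℝ) = |∑ x ∈ A, ((χ x : ℤ) : ℝ)| := by
  rw [Nat.cast_natAbs, colorSum]
  push_cast
  rfl

section

variable {n : ℕ} [NeZero n]

theorem image_range_mem_modularAP (a d : ZMod n) (l : ℕ) :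
    (range l).image (fun k : ℕ => a + (k : ZMod n) * d) ∈ modularAP n := by
  simp only [modularAP, mem_filter, mem_univ, true_and]
  exact ⟨a, d, l, by congr!⟩

theorem abs_sum_range_le_of_natAbs_colorSum_le {χ : ZMod n → ℤˣ} {D : ℕ}
    (hD : ∀ A ∈ modularAP n, (colorSum χ A).natAbs ≤ D) {a d : ZMod n} {l : ℕ}
    (hd : ∀ s < l, ∀ t < l, (s : ZMod n) * d = t * d → s = t) :
    |∑ s ∈ range l, ((χ (a + s * d) : ℤ) : ℝ)| ≤ D := by
  classical
  have h := hD _ (image_range_mem_modularAP a d l)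
  have h' : ((colorSum χ _).natAbs : ℝ) ≤ D := Nat.cast_le.2 h
  rw [natCast_natAbs_colorSum_eq, sum_image] at h'
  · exact h'
  · intro s hs t ht hst
    simp only [coe_range, Set.mem_Iio] at hs ht
    exact hd s hs t ht (add_left_cancel hst)

end

theorem card_filter_dvd_sub_le {c q s : ℕ} (hq : 0 < q) :
    #((range (c * q)).filter fun t : ℕ => (q : ℤ) ∣ (t : ℤ) - (s : ℤ)) ≤ c := by
  have h : #((range (c * q)).filter fun t : ℕ => (q : ℤ) ∣ (t : ℤ) - (s : ℤ)) ≤ #(range c) := by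
    refine card_le_card_of_injOn (fun t => t / q) ?_ ?_
    · intro t ht
      simp only [coe_filter, mem_range, Set.mem_ofPred_eq] at ht
      simp only [coe_range, Set.mem_Iio]
      exact (Nat.div_lt_iff_lt_mul hq).2 ht.1
    · intro t ht t' ht' htt
      simp only [coe_filter, mem_range, Set.mem_ofPred_eq] at ht ht'
      have h1 : t ≡ t' [MOD q] := by
        rw [← Int.natCast_modEq_iff]
        exact ((Int.modEq_iff_dvd.2 ht.2).symm).trans (Int.modEq_iff_dvd.2 ht'.2)
      have htt' : t / q = t' / q := htt
      rw [← Nat.div_add_mod t q, ← Nat.div_add_mod t' q, htt', h1]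
  simpa using h

/-- Each row `s` contains one diagonal entry and at most `c` indices congruent to `s` modulo `q`. -/
theorem sum_sum_diagonal_sub_ge {R A B : ℝ} (hR : 0 ≤ R) (hB : 0 ≤ B) {c q : ℕ} (hq : 0 < q) :
    R * ((c * q : ℕ) * (A - B * c)) ≤ ∑ s ∈ range (c * q), ∑ t ∈ range (c * q),
      R * ((if (t : ℤ) - (s : ℤ) = 0 then A else 0) -
        (if (q : ℤ) ∣ (t : ℤ) - (s : ℤ) then B else 0)) := by
  simp only [← mul_sum]
  refine mul_le_mul_of_nonneg_left ?_ hR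
  have : ((c * q : ℕ) : ℝ) * (A - B * c) = ∑ s ∈ range (c * q), (A - B * c) := by
    rw [sum_const, card_range, nsmul_eq_mul]
  rw [this]
  refine sum_le_sum fun s hs => ?_
  rw [sum_sub_distrib]
  have h1 : ∑ t ∈ range (c * q), (if (t : ℤ) - (s : ℤ) = 0 then A else 0) = A := by
    simp only [sub_eq_zero, Nat.cast_inj]
    rw [sum_ite_eq' (range (c * q)) s fun _ => A, if_pos hs]
  rw [h1, ← sum_filter, sum_const, nsmul_eq_mul]
  have h2 : ((#((range (c * q)).filter fun t : ℕ => (q : ℤ) ∣ (t : ℤ) - (s : ℤ)) : ℕ) : ℝ) ≤ c := by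
    exact_mod_cast card_filter_dvd_sub_le hq
  nlinarith

/-- Averaged over the start `a`, progression sums of `P` and of `g` are orthogonal, so the square of
the `P` part may be dropped. -/
theorem sum_sq_sum_range_ge {n : ℕ} [NeZero n] {L : ℕ} (hL0 : L ≠ 0) {q : ZMod n}
    {P g : ZMod n → ℝ} (hP : ∀ (s : ℕ) x, P (x + s * q) = P x)
    (hg : ∀ x, ∑ s ∈ range L, g (x + s * q) = 0) (l : ℕ) (d : ZMod n) :
    ∑ a, (∑ s ∈ range l, g (a + s * d)) ^ 2 ≤
      ∑ a, (∑ s ∈ range l, (P (a + s * d) + g (a + s * d))) ^ 2 := by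
  have hcross : ∑ a, (∑ s ∈ range l, P (a + s * d)) * (∑ t ∈ range l, g (a + t * d)) = 0 := by
    simp only [sum_mul_sum]
    rw [sum_comm]
    refine sum_eq_zero fun s _ => ?_
    rw [sum_comm]
    refine sum_eq_zero fun t _ => ?_
    rw [← sum_periodic_mul_eq_zero hL0 hP hg (t * d - s * d)]
    symm
    rw [← Equiv.sum_comp (Equiv.addRight ((s : ZMod n) * d))]
    refine sum_congr rfl fun b _ => ?_
    simp only [Equiv.coe_addRight]
    congr 2
    ring
  have hexp : ∑ a, (∑ s ∈ range l, (P (a + s * d) + g (a + s * d))) ^ 2 =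
      ∑ a, (∑ s ∈ range l, P (a + s * d)) ^ 2 +
        2 * ∑ a, (∑ s ∈ range l, P (a + s * d)) * (∑ t ∈ range l, g (a + t * d)) +
        ∑ a, (∑ s ∈ range l, g (a + s * d)) ^ 2 := by
    rw [mul_sum, ← sum_add_distrib, ← sum_add_distrib]
    refine sum_congr rfl fun a _ => ?_
    rw [sum_add_distrib]
    ring
  rw [hexp, hcross]
  have : 0 ≤ ∑ a, (∑ s ∈ range l, P (a + s * d)) ^ 2 := sum_nonneg fun _ _ => sq_nonneg _
  linarith

theorem sq_ge_of_natAbs_colorSum_le {p k : ℕ} [NeZero (p ^ k)] (hp : p.Prime) {e m : ℕ}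
    (hem : e + (m + 1) = k) {χ : ZMod (p ^ k) → ℤˣ} {D : ℕ}
    (hD : ∀ A ∈ modularAP (p ^ k), (colorSum χ A).natAbs ≤ D) {c : ℕ} (hc : c ≤ p) :
    (1 - (D : ℝ) ^ 2 / ((p : ℝ) ^ (m + 1)) ^ 2) * (c * (p : ℝ) ^ e * (1 - c / p)) ≤
      (D : ℝ) ^ 2 := by
  classical
  have hk : 0 < k := by omega
  have hp0 : (0 : ℝ) < p := by exact_mod_cast hp.pos
  set L := p ^ (m + 1) with hLdef
  have hL0 : L ≠ 0 := (pow_pos hp.pos _).ne'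
  have hLr : (0 : ℝ) < L := by exact_mod_cast Nat.pos_of_ne_zero hL0
  set q : ZMod (p ^ k) := (p : ZMod (p ^ k)) ^ e with hqdef
  have hLq : (L : ZMod (p ^ k)) * q = 0 := by
    rw [hqdef, hLdef]
    have := ZMod.natCast_self (p ^ k)
    have h2 : ((p ^ (m + 1) * p ^ e : ℕ) : ZMod (p ^ k)) = 0 := by
      rw [← pow_add, add_comm, hem, this]
    exact_mod_cast h2
  set f : ZMod (p ^ k) → ℝ := fun x => ((χ x : ℤ) : ℝ) with hf
  set P : ZMod (p ^ k) → ℝ := fun x => (∑ s ∈ range L, f (x + s * q)) / L with hPdef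
  set g : ZMod (p ^ k) → ℝ := fun x => f x - P x with hgdef
  have hP : ∀ (s : ℕ) x, P (x + s * q) = P x := fun s x => by
    simp only [hPdef, sum_range_add_nsmul_periodic hLq]
  have hg : ∀ x, ∑ s ∈ range L, g (x + s * q) = 0 := fun x => by
    simp only [hgdef, sum_sub_distrib, hP, sum_const, card_range, nsmul_eq_mul]
    simp only [hPdef]
    field_simp
    simp
  have hPg : ∀ x, P x + g x = f x := fun x => by simp [hgdef]
  have hff : ∀ x, f x * f x = 1 := fun x => by
    rcases Int.units_eq_one_or (χ x) with h | h <;> simp [hf, h]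
  have hPD : ∀ x, P x * P x ≤ (D : ℝ) ^ 2 / (L : ℝ) ^ 2 := fun x => by
    have h1 : |∑ s ∈ range L, f (x + s * q)| ≤ D := by
      refine abs_sum_range_le_of_natAbs_colorSum_le hD fun s hs t ht hst => ?_
      have h2 : ((s * p ^ e : ℕ) : ZMod (p ^ k)) = ((t * p ^ e : ℕ) : ZMod (p ^ k)) := by
        push_cast; exact hst
      rw [ZMod.natCast_eq_natCast_iff', Nat.mod_eq_of_lt, Nat.mod_eq_of_lt] at h2
      · exact Nat.eq_of_mul_eq_mul_right (pow_pos hp.pos _) h2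
      · rw [← hem, pow_add, mul_comm]; exact Nat.mul_lt_mul_of_pos_left ht (pow_pos hp.pos _)
      · rw [← hem, pow_add, mul_comm]; exact Nat.mul_lt_mul_of_pos_left hs (pow_pos hp.pos _)
    have h3 : P x * P x = (∑ s ∈ range L, f (x + s * q)) ^ 2 / (L : ℝ) ^ 2 := by
      simp only [hPdef]; ring
    rw [h3]
    refine div_le_div_of_nonneg_right ?_ (sq_nonneg _)
    exact sq_le_sq' (abs_le.1 h1).1 (abs_le.1 h1).2
  have hN : (0 : ℝ) < (p : ℝ) ^ k := by positivity
  -- Pythagoras: `f` has mass `p ^ k`, and `P` takes at most `D ^ 2 / L ^ 2` of it per point.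
  have hR : (p : ℝ) ^ k * (1 - (D : ℝ) ^ 2 / (L : ℝ) ^ 2) ≤ autocorr g 0 := by
    have h1 : ∑ x, f x * f x = (p : ℝ) ^ k := by simp [hff, ZMod.card]
    have h2 : ∑ x, P x * P x ≤ (p : ℝ) ^ k * ((D : ℝ) ^ 2 / (L : ℝ) ^ 2) := by
      refine (sum_le_card_nsmul _ _ _ fun x _ => hPD x).trans ?_
      simp [ZMod.card]
    have h3 := sum_periodic_mul_eq_zero hL0 hP hg 0
    have h4 : ∑ x, f x * f x = ∑ x, P x * P x + 2 * ∑ x, P x * g (x + 0) + autocorr g 0 := by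
      simp only [autocorr, add_zero]
      rw [mul_sum, ← sum_add_distrib, ← sum_add_distrib]
      refine sum_congr rfl fun x _ => ?_
      rw [← hPg]; ring
    rw [h3] at h4
    linarith
  set l := c * p ^ e with hl
  have hlk : l ≤ p ^ k := by
    rw [hl, ← hem]
    calc c * p ^ e ≤ p * p ^ e := Nat.mul_le_mul_right _ hc
      _ = p ^ (e + 1) := by ring
      _ ≤ _ := Nat.pow_le_pow_right hp.pos (by omega)
  have hupper : ∑ d : ZMod (p ^ k) with IsUnit d, ∑ a, (∑ s ∈ range l, f (a + s * d)) ^ 2 ≤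
      (p : ℝ) ^ k * ((p : ℝ) ^ k * (D : ℝ) ^ 2) := by
    have h1 : ∀ d ∈ (univ.filter fun d : ZMod (p ^ k) => IsUnit d),
        ∑ a, (∑ s ∈ range l, f (a + s * d)) ^ 2 ≤ (p : ℝ) ^ k * (D : ℝ) ^ 2 := by
      intro d hd
      refine (sum_le_card_nsmul _ _ ((D : ℝ) ^ 2) fun a _ => ?_).trans ?_
      · have h1 : |∑ s ∈ range l, f (a + s * d)| ≤ D := by
          refine abs_sum_range_le_of_natAbs_colorSum_le hD fun s hs t ht hst => ?_
          have h2 := (mem_filter.1 hd).2.mul_right_cancel hst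
          rwa [ZMod.natCast_eq_natCast_iff', Nat.mod_eq_of_lt (by omega),
            Nat.mod_eq_of_lt (by omega)] at h2
        exact sq_le_sq' (abs_le.1 h1).1 (abs_le.1 h1).2
      · simp [ZMod.card]
    refine (sum_le_card_nsmul _ _ _ h1).trans ?_
    rw [nsmul_eq_mul]
    gcongr
    have := card_filter_le (univ : Finset (ZMod (p ^ k))) (fun d => IsUnit d)
    rw [card_univ, ZMod.card] at this
    exact_mod_cast this
  have hlower : autocorr g 0 * (l * ((p : ℝ) ^ k - (p : ℝ) ^ (k - 1) * c)) ≤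
      ∑ d : ZMod (p ^ k) with IsUnit d, ∑ a, (∑ s ∈ range l, g (a + s * d)) ^ 2 := by
    simp only [sum_sq_sum_range]
    rw [sum_comm]
    simp only [sum_comm (s := univ.filter fun d : ZMod (p ^ k) => IsUnit d)]
    refine (sum_sum_diagonal_sub_ge (autocorr_zero_nonneg g) (by positivity)
      (pow_pos hp.pos e)).trans ?_
    refine sum_le_sum fun s hs => sum_le_sum fun t ht => ?_
    have := sum_isUnit_autocorr_ge hp hk hL0 hg (h := (t : ℤ) - (s : ℤ)) ?_
    · push_cast
      push_cast at this
      exact this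
    · by_cases hst : (t : ℤ) - (s : ℤ) = 0
      · exact Or.inl hst
      -- Since `c ≤ p`, distinct indices differ by less than `l ≤ p ^ (e + 1)`.
      · right
        intro hdvd
        have h1 := Int.le_of_dvd (abs_pos.2 hst) ((dvd_abs _ _).2 hdvd)
        have h2 : l ≤ p ^ (e + 1) := by
          rw [hl, pow_succ, mul_comm]; exact Nat.mul_le_mul_left _ hc
        have h3 : (l : ℤ) ≤ (p : ℤ) ^ (e + 1) := by exact_mod_cast h2
        rw [mem_range] at hs ht
        have h4 : |(t : ℤ) - (s : ℤ)| < l := by rw [abs_lt]; omega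
        omega
  have hmid : ∑ d : ZMod (p ^ k) with IsUnit d, ∑ a, (∑ s ∈ range l, g (a + s * d)) ^ 2 ≤
      ∑ d : ZMod (p ^ k) with IsUnit d, ∑ a, (∑ s ∈ range l, f (a + s * d)) ^ 2 := by
    refine sum_le_sum fun d _ => ?_
    have := sum_sq_sum_range_ge hL0 hP hg l d
    simpa only [hPg] using this
  have hpk : (p : ℝ) ^ (k - 1) = (p : ℝ) ^ k / p := by
    rw [eq_div_iff hp0.ne', ← pow_succ, Nat.sub_add_cancel hk]
  have hcp : (0 : ℝ) ≤ 1 - c / p := by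
    rw [sub_nonneg, div_le_one hp0]; exact_mod_cast hc
  have hfin := (hlower.trans hmid).trans hupper
  have h5 : (p : ℝ) ^ k - (p : ℝ) ^ (k - 1) * c = (p : ℝ) ^ k * (1 - c / p) := by
    rw [hpk]; ring
  rw [h5] at hfin
  have h6 : (p : ℝ) ^ k * (1 - (D : ℝ) ^ 2 / (L : ℝ) ^ 2) * (l * ((p : ℝ) ^ k * (1 - c / p))) ≤
      (p : ℝ) ^ k * ((p : ℝ) ^ k * (D : ℝ) ^ 2) :=
    (mul_le_mul_of_nonneg_right hR (by positivity)).trans hfin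
  have h7 : (p : ℝ) ^ k * ((p : ℝ) ^ k *
      ((1 - (D : ℝ) ^ 2 / (L : ℝ) ^ 2) * (l * (1 - c / p)))) ≤
      (p : ℝ) ^ k * ((p : ℝ) ^ k * (D : ℝ) ^ 2) := by
    refine le_trans (le_of_eq ?_) h6
    ring
  have h8 := le_of_mul_le_mul_left (le_of_mul_le_mul_left h7 hN) hN
  simpa [hLdef, hl] using h8

/-- The choice `m = k / 3` is what gives `2 * (m + 1) ≥ k - m`, so that the loss from coset averages
is harmless. -/
theorem pow_le_sixteen_mul_sq {p k : ℕ} [NeZero (p ^ k)] (hp : p.Prime) (hk : 0 < k)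
    {χ : ZMod (p ^ k) → ℤˣ} {D : ℕ}
    (hD : ∀ A ∈ modularAP (p ^ k), (colorSum χ A).natAbs ≤ D) :
    (p : ℝ) ^ (k - k / 3) ≤ 16 * (D : ℝ) ^ 2 := by
  obtain ⟨e, he⟩ : ∃ e, e + (k / 3 + 1) = k := ⟨k - (k / 3 + 1), by omega⟩
  set m := k / 3 with hm
  have h := sq_ge_of_natAbs_colorSum_le hp he hD (Nat.div_le_self p 2)
  have hp0 : (0 : ℝ) < p := by exact_mod_cast hp.pos
  have hp1 : (1 : ℝ) ≤ p := by exact_mod_cast hp.one_lt.le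
  -- The ratio lies in [1/3, 1/2], the minimum occurring at `p = 3`; hence `x * (1 - x) ≥ 2 / 9`.
  set x : ℝ := ((p / 2 : ℕ) : ℝ) / p with hx
  have hx1 : x ≤ 1 / 2 := by
    rw [hx, div_le_div_iff₀ hp0 two_pos]
    have : p / 2 * 2 ≤ 1 * p := by omega
    exact_mod_cast this
  have hx2 : 1 / 3 ≤ x := by
    rw [hx, div_le_div_iff₀ three_pos hp0]
    have : 1 * p ≤ p / 2 * 3 := by have := hp.two_le; omega
    exact_mod_cast this
  set R : ℝ := (p : ℝ) ^ (k - m) with hR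
  have hR0 : 0 < R := by positivity
  have hRL : R ≤ ((p : ℝ) ^ (m + 1)) ^ 2 := by
    rw [← pow_mul]
    exact pow_le_pow_right₀ hp1 (by omega)
  have hl : ((p / 2 : ℕ) : ℝ) * (p : ℝ) ^ e = x * R := by
    rw [hR, show k - m = e + 1 by omega, hx, pow_succ]
    field_simp
  rw [hl] at h
  have hdiv : (D : ℝ) ^ 2 / ((p : ℝ) ^ (m + 1)) ^ 2 ≤ (D : ℝ) ^ 2 / R :=
    div_le_div_of_nonneg_left (sq_nonneg _) hR0 hRL
  have hx3 : 0 ≤ x * R * (1 - x) := by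
    have : 0 ≤ 1 - x := by linarith
    positivity
  have h2 : (1 - (D : ℝ) ^ 2 / R) * (x * R * (1 - x)) ≤ (D : ℝ) ^ 2 :=
    (mul_le_mul_of_nonneg_right (by linarith) hx3).trans h
  have h3 : (1 - (D : ℝ) ^ 2 / R) * (x * R * (1 - x)) = (R - (D : ℝ) ^ 2) * (x * (1 - x)) := by
    field_simp
  rw [h3] at h2
  have h4 : 2 / 9 ≤ x * (1 - x) := by nlinarith
  have h5 : x * (1 - x) ≤ 1 / 4 := by nlinarith [sq_nonneg (x - 1 / 2)]
  nlinarith [sq_nonneg (D : ℝ)]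

/-! ### Partial colouring by an entropy-type count -/

theorem sum_units_int {M : Type*} [AddCommMonoid M] (f : ℤˣ → M) : ∑ x, f x = f 1 + f (-1) := by
  rw [show (univ : Finset ℤˣ) = {1, -1} by decide, sum_pair (by decide)]

section

variable {ι κ : Type*} [Fintype ι] [Fintype κ]

theorem sum_prod_units_int [DecidableEq ι] (f : ι → ℤˣ → ℝ) :
    ∑ χ : ι → ℤˣ, ∏ j, f j (χ j) = ∏ j, (f j 1 + f j (-1)) := by
  rw [← Fintype.piFinset_univ, ← prod_univ_sum]
  simp only [sum_units_int]

theorem card_signs [DecidableEq ι] : Fintype.card (ι → ℤˣ) = 2 ^ Fintype.card ι := by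
  simp

theorem sum_exp_linear_le [DecidableEq ι] (a : ι → ℝ) :
    ∑ χ : ι → ℤˣ, Real.exp (∑ j, a j * ((χ j : ℤ) : ℝ)) ≤
      2 ^ Fintype.card ι * Real.exp ((∑ j, a j ^ 2) / 2) := by
  simp only [Real.exp_sum]
  rw [sum_prod_units_int fun j x => Real.exp (a j * ((x : ℤ) : ℝ)), sum_div, Real.exp_sum,
    ← card_univ, ← prod_const, ← prod_mul_distrib]
  refine prod_le_prod (fun j _ => by positivity) fun j _ => ?_
  have h := Real.cosh_le_exp_half_sq (a j)
  rw [Real.cosh_eq] at h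
  simp only [Units.val_one, Int.cast_one, mul_one, Units.val_neg, Int.cast_neg, mul_neg]
  linarith

theorem sum_pow_natAbs_le {r : ℝ} (hr : 0 ≤ r) (hr2 : r ≤ 1 / 2) (B : ℕ) :
    ∑ b ∈ Icc (-(B : ℤ)) B, r ^ b.natAbs ≤ 1 + 4 * r := by
  -- The subtracted term strengthens the claim enough for the induction to close.
  have h : ∑ b ∈ Icc (-(B : ℤ)) B, r ^ b.natAbs ≤ 1 + 4 * r - 4 * r ^ (B + 1) := by
    induction B with
    | zero => simp
    | succ B ih =>
      have hs : Icc (-((B + 1 : ℕ) : ℤ)) (B + 1 : ℕ) =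
          insert ((B + 1 : ℕ) : ℤ) (insert (-((B + 1 : ℕ) : ℤ)) (Icc (-(B : ℤ)) B)) := by
        ext x
        simp only [mem_Icc, mem_insert]
        omega
      rw [hs, sum_insert, sum_insert]
      · rw [Int.natAbs_neg, Int.natAbs_natCast, pow_succ r (B + 1)]
        have : 0 ≤ r ^ (B + 1) := by positivity
        nlinarith
      · simp
      · simp only [mem_Icc, mem_insert]
        omega
  have : 0 ≤ r ^ (B + 1) := by positivity
  linarith

/-- A nonzero integer `b` nearest to `y` satisfies `|b| / 2 ≤ |b| - 1 / 2 ≤ |y|`. -/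
theorem natAbs_round_mul_le {x D : ℝ} (hD : 0 < D) :
    ((round (x / (2 * D))).natAbs : ℝ) * D ≤ |x| := by
  rw [Nat.cast_natAbs, Int.cast_abs]
  by_cases hb : round (x / (2 * D)) = 0
  · simp [hb]
  · have h1 : (1 : ℝ) ≤ |(round (x / (2 * D)) : ℝ)| := by
      exact_mod_cast Int.one_le_abs hb
    have h2 := abs_sub_round (x / (2 * D))
    have h3 := abs_sub_abs_le_abs_sub ((round (x / (2 * D)) : ℝ)) (x / (2 * D))
    rw [abs_sub_comm] at h3
    have h4 : |x / (2 * D)| = |x| / (2 * D) := by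
      rw [abs_div, abs_of_pos (show 0 < 2 * D by positivity)]
    rw [h4] at h3
    have h5 : |(round (x / (2 * D)) : ℝ)| / 2 ≤ |x| / (2 * D) := by linarith
    rw [div_le_div_iff₀ two_pos (by positivity)] at h5
    linarith

/-- Exponential moments with parameter `± D / s`: a nonzero rounded value forces `D * |x| / s ≥ u`,
so its cost is at most `exp (-7u/8)` times the two-sided exponential, whose mean is at most `2 * exp
(u/2)`. -/
theorem sum_round_cost_le [DecidableEq ι] {a : ι → ℝ} {D s : ℝ} (hD : 0 < D) (hs : 0 < s)
    (ha : ∑ j, a j ^ 2 ≤ s) :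
    ∑ χ : ι → ℤˣ, D ^ 2 / s / 8 *
      ((round ((∑ j, a j * ((χ j : ℤ) : ℝ)) / (2 * D))).natAbs : ℝ) ≤
      2 ^ Fintype.card ι * (2 * Real.exp (-(D ^ 2 / s / 8))) := by
  set u := D ^ 2 / s with hu
  have hu0 : 0 < u := by positivity
  have key : ∀ x : ℝ, u / 8 * ((round (x / (2 * D))).natAbs : ℝ) ≤
      Real.exp (-(7 * u / 8)) * (Real.exp (D / s * x) + Real.exp (-(D / s) * x)) := by
    intro x
    by_cases hb : (round (x / (2 * D))).natAbs = 0
    · rw [hb]; simp only [Nat.cast_zero, mul_zero]; positivity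
    · have h1 : (1 : ℝ) ≤ (round (x / (2 * D))).natAbs := by
        exact_mod_cast Nat.one_le_iff_ne_zero.2 hb
      have h2 := natAbs_round_mul_le (x := x) hD
      set b : ℝ := ((round (x / (2 * D))).natAbs : ℝ)
      have h3 : u * b ≤ D / s * |x| := by
        have : u * b = D / s * (b * D) := by rw [hu]; field_simp
        rw [this]
        gcongr
      have h4 : u ≤ u * b := by nlinarith
      set z := D / s * |x| with hz
      have h5 : u / 8 * b ≤ Real.exp (z / 8) := by
        have := Real.add_one_le_exp (z / 8)
        linarith
      have h6 : Real.exp (z / 8) ≤ Real.exp (-(7 * u / 8)) * Real.exp z := by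
        rw [← Real.exp_add]
        exact Real.exp_le_exp.2 (by linarith)
      have h7 : Real.exp z ≤ Real.exp (D / s * x) + Real.exp (-(D / s) * x) := by
        rcases abs_choice x with h | h
        · rw [hz, h]; linarith [Real.exp_pos (-(D / s) * x)]
        · rw [hz, h, mul_neg, ← neg_mul]; linarith [Real.exp_pos (D / s * x)]
      exact h5.trans (h6.trans (mul_le_mul_of_nonneg_left h7 (Real.exp_pos _).le))
  have mgf : ∀ t : ℝ, t ^ 2 = (D / s) ^ 2 →
      ∑ χ : ι → ℤˣ, Real.exp (t * ∑ j, a j * ((χ j : ℤ) : ℝ)) ≤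
        2 ^ Fintype.card ι * Real.exp (u / 2) := by
    intro t ht
    have h := sum_exp_linear_le fun j => t * a j
    simp only [mul_assoc, ← mul_sum] at h
    refine h.trans ?_
    gcongr
    simp only [mul_pow]
    rw [← mul_sum, ht]
    calc (D / s) ^ 2 * ∑ j, a j ^ 2 ≤ (D / s) ^ 2 * s := by gcongr
      _ = u := by rw [hu]; field_simp
  refine (sum_le_sum fun χ _ => key _).trans ?_
  rw [← mul_sum, sum_add_distrib]
  have h1 := mgf (D / s) rfl
  have h2 := mgf (-(D / s)) (by ring)
  calc Real.exp (-(7 * u / 8)) * _ ≤ Real.exp (-(7 * u / 8)) *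
        (2 ^ Fintype.card ι * Real.exp (u / 2) + 2 ^ Fintype.card ι * Real.exp (u / 2)) := by
        gcongr
    _ = 2 ^ Fintype.card ι * (2 * (Real.exp (-(7 * u / 8)) * Real.exp (u / 2))) := by ring
    _ ≤ _ := by
        rw [← Real.exp_add]
        gcongr
        linarith

/-- Round every linear form to a multiple of `2 * D i`. Two colourings with the same rounded vector
have half-difference within all bounds; the task is to find two that differ in many places.
Otherwise all fibres are small Hamming clusters. Weighting the rounded vectors by `w`, whose total
is controlled by a Kraft-type product, then contradicts the small average cost `K`. -/
theorem exists_partial_coloring (a : κ → ι → ℝ) (D s : κ → ℝ) (hD : ∀ i, 0 < D i)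
    (hs : ∀ i, 0 < s i) (ha : ∀ i, ∑ j, a i j ^ 2 ≤ s i) (hu : ∀ i, 8 ≤ D i ^ 2 / s i)
    (hsum : ∑ i, Real.exp (-(D i ^ 2 / s i / 8)) ≤ (Fintype.card ι : ℝ) / 60) :
    ∃ ε : ι → ℤ, (∀ j, ε j = 0 ∨ ε j = 1 ∨ ε j = -1) ∧
      Fintype.card ι ≤ 8 * #{j | ε j ≠ 0} ∧ ∀ i, |∑ j, a i j * (ε j : ℝ)| ≤ D i := by
  classical
  set M := Fintype.card ι with hM
  rcases Nat.eq_zero_or_pos M with hM0 | hMpos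
  · refine ⟨fun _ => 0, fun _ => Or.inl rfl, by omega, fun i => ?_⟩
    simpa using (hD i).le
  set u : κ → ℝ := fun i => D i ^ 2 / s i with hudef
  set r : κ → ℝ := fun i => Real.exp (-(u i / 8)) with hr
  set lin : κ → (ι → ℤˣ) → ℝ := fun i χ => ∑ j, a i j * ((χ j : ℤ) : ℝ) with hlin
  set b : (ι → ℤˣ) → κ → ℤ := fun χ i => round (lin i χ / (2 * D i)) with hb
  set K : (ι → ℤˣ) → ℝ := fun χ => ∑ i, u i / 8 * ((b χ i).natAbs : ℝ) with hK
  set w : (κ → ℤ) → ℝ := fun β => ∏ i, r i ^ (β i).natAbs with hw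
  have hr0 : ∀ i, 0 ≤ r i := fun i => (Real.exp_pos _).le
  have hr2 : ∀ i, r i ≤ 1 / 2 := fun i => by
    have h1 : r i ≤ Real.exp (-1) := Real.exp_le_exp.2 (by have := hu i; simp only [hudef]; linarith)
    have := Real.exp_neg_one_lt_d9
    linarith
  have hKw : ∀ χ, Real.exp (-K χ) = w (b χ) := fun χ => by
    simp only [hK, hw, hr, ← sum_neg_distrib, Real.exp_sum, ← Real.exp_nat_mul]
    refine prod_congr rfl fun i _ => ?_
    congr 1; ring
  have hKsum : ∑ χ, K χ ≤ 2 ^ M * ((M : ℝ) / 30) := by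
    simp only [hK]
    rw [sum_comm]
    calc _ ≤ ∑ i, (2 : ℝ) ^ M * (2 * Real.exp (-(D i ^ 2 / s i / 8))) :=
          sum_le_sum fun i _ => sum_round_cost_le (hD i) (hs i) (ha i)
      _ = 2 ^ M * (2 * ∑ i, Real.exp (-(D i ^ 2 / s i / 8))) := by rw [mul_sum, mul_sum]
      _ ≤ _ := by gcongr; linarith
  -- Jensen's inequality in tangent-line form: `exp (-K)` is bounded below by its tangent at `M /
  -- 30`, an upper bound for the mean of `K`.
  have hlow : 2 ^ M * Real.exp (-((M : ℝ) / 30)) ≤ ∑ χ, w (b χ) := by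
    have h1 : ∀ χ, Real.exp (-((M : ℝ) / 30)) * (1 + M / 30 - K χ) ≤ w (b χ) := fun χ => by
      rw [← hKw, show -K χ = -((M : ℝ) / 30) + (M / 30 - K χ) by ring, Real.exp_add]
      gcongr
      linarith [Real.add_one_le_exp ((M : ℝ) / 30 - K χ)]
    refine le_trans ?_ (sum_le_sum fun χ _ => h1 χ)
    rw [← mul_sum, sum_sub_distrib, sum_const, card_univ, card_signs, nsmul_eq_mul, mul_comm]
    push_cast
    gcongr
    linarith
  set q : ℝ := (1 + Real.exp (-1)) * Real.exp (1 / 8) with hq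
  by_contra hcon
  push Not at hcon
  have hclose : ∀ χ χ₀, b χ = b χ₀ → 8 * #{j | χ j ≠ χ₀ j} ≤ M := by
    intro χ χ₀ hχ
    by_contra hfar
    obtain ⟨i, hi⟩ := hcon (fun j => if χ j = χ₀ j then 0 else (χ j : ℤ))
      (fun j => by
        by_cases h : χ j = χ₀ j
        · simp [h]
        · rw [if_neg h]
          rcases Int.units_eq_one_or (χ j) with h' | h' <;> simp [h'])
      (by
        have : ∀ j, ((if χ j = χ₀ j then 0 else (χ j : ℤ)) ≠ 0 ↔ χ j ≠ χ₀ j) := fun j => by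
          by_cases h : χ j = χ₀ j <;> simp [h]
        simp only [this]
        omega)
    refine hi.not_ge ?_
    have hdiff : ∑ j, a i j * (((if χ j = χ₀ j then 0 else (χ j : ℤ)) : ℤ) : ℝ) =
        (lin i χ - lin i χ₀) / 2 := by
      simp only [hlin]
      rw [← sum_sub_distrib, sum_div]
      refine sum_congr rfl fun j _ => ?_
      rcases Int.units_eq_one_or (χ j) with h | h <;>
        rcases Int.units_eq_one_or (χ₀ j) with h' | h' <;> simp [h, h'] <;> ring
    rw [hdiff]
    have h1 := abs_sub_round (lin i χ / (2 * D i))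
    have h2 := abs_sub_round (lin i χ₀ / (2 * D i))
    have h3 : round (lin i χ / (2 * D i)) = round (lin i χ₀ / (2 * D i)) := congrFun hχ i
    rw [h3] at h1
    have h4 : |lin i χ / (2 * D i) - lin i χ₀ / (2 * D i)| ≤ 1 := by
      rw [abs_le] at *
      constructor <;> linarith
    rw [← sub_div, abs_div, abs_of_pos (show 0 < 2 * D i by linarith [hD i]),
      div_le_one (by linarith [hD i])] at h4
    rw [abs_div, abs_two]
    linarith
  -- Weight each colouring by `exp (-1)` per disagreement with `χ₀`; every member of the fibre has
  -- weight at least `exp (-M / 8)`.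
  have hfiber : ∀ β, (#{χ | b χ = β} : ℝ) ≤ q ^ M := by
    intro β
    rcases (univ.filter fun χ => b χ = β).eq_empty_or_nonempty with h0 | ⟨χ₀, hχ₀⟩
    · rw [h0]; simp only [card_empty, Nat.cast_zero]; positivity
    have hχ₀' := (mem_filter.1 hχ₀).2
    have htot : ∑ χ : ι → ℤˣ, ∏ j, (if χ j ≠ χ₀ j then Real.exp (-1) else 1) =
        (1 + Real.exp (-1)) ^ M := by
      rw [sum_prod_units_int fun j x => if x ≠ χ₀ j then Real.exp (-1) else 1, hM, ← card_univ,
        ← prod_const]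
      refine prod_congr rfl fun j _ => ?_
      rcases Int.units_eq_one_or (χ₀ j) with h | h
      · rw [h, if_neg (by simp), if_pos (by decide)]
      · rw [h, if_pos (by decide), if_neg (by simp), add_comm]
    have hpart : (#{χ | b χ = β} : ℝ) * Real.exp (-((M : ℝ) / 8)) ≤
        ∑ χ : ι → ℤˣ, ∏ j, (if χ j ≠ χ₀ j then Real.exp (-1) else 1) := by
      rw [← nsmul_eq_mul]
      refine le_trans (card_nsmul_le_sum _ _ _ fun χ hχ => ?_)
        (sum_le_sum_of_subset_of_nonneg (filter_subset (fun χ => b χ = β) univ)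
          fun χ _ _ => prod_nonneg fun j _ => by split_ifs <;> positivity)
      have hd := hclose χ χ₀ ((mem_filter.1 hχ).2.trans hχ₀'.symm)
      rw [prod_ite, prod_const, prod_const, one_pow, mul_one, ← Real.exp_nat_mul]
      refine Real.exp_le_exp.2 ?_
      have hd' : (8 : ℝ) * (#{j | χ j ≠ χ₀ j} : ℕ) ≤ M := by exact_mod_cast hd
      linarith
    rw [htot] at hpart
    have h8 : Real.exp (-((M : ℝ) / 8)) * Real.exp (1 / 8) ^ M = 1 := by
      rw [← Real.exp_nat_mul, ← Real.exp_add, Real.exp_eq_one_iff]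
      ring
    calc (#{χ | b χ = β} : ℝ)
        = (#{χ | b χ = β} : ℝ) * Real.exp (-((M : ℝ) / 8)) * Real.exp (1 / 8) ^ M := by
          rw [mul_assoc, h8, mul_one]
      _ ≤ (1 + Real.exp (-1)) ^ M * Real.exp (1 / 8) ^ M := by gcongr
      _ = q ^ M := by rw [hq, mul_pow]
  obtain ⟨B, hB⟩ : ∃ B : ℕ, ∀ χ i, (b χ i).natAbs ≤ B :=
    ⟨univ.sup fun χ => univ.sup fun i => (b χ i).natAbs, fun χ i =>
      (le_sup (f := fun i => (b χ i).natAbs) (mem_univ i)).trans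
        (le_sup (f := fun χ => univ.sup fun i => (b χ i).natAbs) (mem_univ χ))⟩
  have hw0 : ∀ β, 0 ≤ w β := fun β => prod_nonneg fun i _ => pow_nonneg (hr0 i) _
  have hkraft : ∑ β ∈ univ.image b, w β ≤ Real.exp ((M : ℝ) / 15) := by
    calc ∑ β ∈ univ.image b, w β
        ≤ ∑ β ∈ Fintype.piFinset fun _ : κ => Icc (-(B : ℤ)) B, w β := by
          refine sum_le_sum_of_subset_of_nonneg ?_ fun β _ _ => hw0 β
          intro β hβ
          obtain ⟨χ, -, rfl⟩ := mem_image.1 hβ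
          refine Fintype.mem_piFinset.2 fun i => ?_
          have := hB χ i
          rw [mem_Icc]
          omega
      _ = ∏ i, ∑ β ∈ Icc (-(B : ℤ)) B, r i ^ β.natAbs := by
          rw [prod_univ_sum]
      _ ≤ ∏ i, Real.exp (4 * r i) := by
          refine prod_le_prod (fun i _ => sum_nonneg fun _ _ => pow_nonneg (hr0 i) _)
            fun i _ => (sum_pow_natAbs_le (hr0 i) (hr2 i) B).trans ?_
          linarith [Real.add_one_le_exp (4 * r i)]
      _ = Real.exp (4 * ∑ i, r i) := by rw [mul_sum, Real.exp_sum]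
      _ ≤ _ := Real.exp_le_exp.2 (by linarith)
  have hup : ∑ χ, w (b χ) ≤ q ^ M * Real.exp ((M : ℝ) / 15) := by
    rw [sum_comp w b]
    calc _ ≤ ∑ β ∈ univ.image b, q ^ M * w β := by
          refine sum_le_sum fun β _ => ?_
          rw [nsmul_eq_mul]
          exact mul_le_mul_of_nonneg_right (hfiber β) (hw0 β)
      _ ≤ _ := by rw [← mul_sum]; gcongr
  -- The exponent is 1/10 = 1/15 + 1/30, from `hkraft` and `hlow`.
  have hlt : q * Real.exp (1 / 10) < 2 := by
    rw [hq, mul_assoc, ← Real.exp_add]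
    have h1 := Real.exp_neg_one_lt_d9
    have h2 : Real.exp (1 / 8 + 1 / 10) ≤ 1 / (1 - (1 / 8 + 1 / 10)) := by
      rw [le_div_iff₀ (by norm_num)]
      have h3 := Real.add_one_le_exp (-(1 / 8 + 1 / 10 : ℝ))
      have h4 : Real.exp (1 / 8 + 1 / 10) * Real.exp (-(1 / 8 + 1 / 10)) = 1 := by
        rw [← Real.exp_add]; simp
      have h5 := Real.exp_pos (1 / 8 + 1 / 10)
      nlinarith
    have h6 := Real.exp_pos (-1)
    have h7 := Real.exp_pos (1 / 8 + 1 / 10)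
    norm_num at *
    nlinarith
  have hfin := hlow.trans hup
  have h9 : (2 : ℝ) ^ M ≤ (q * Real.exp (1 / 10)) ^ M := by
    rw [mul_pow, ← Real.exp_nat_mul]
    have h10 : Real.exp (-((M : ℝ) / 30)) * Real.exp (M / 30) = 1 := by
      rw [← Real.exp_add]; simp
    calc (2 : ℝ) ^ M = 2 ^ M * Real.exp (-((M : ℝ) / 30)) * Real.exp (M / 30) := by
          rw [mul_assoc, h10, mul_one]
      _ ≤ q ^ M * Real.exp ((M : ℝ) / 15) * Real.exp (M / 30) := by gcongr
      _ = _ := by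
          rw [mul_assoc, ← Real.exp_add]
          congr 2
          ring
  exact absurd h9 (not_le.2 (pow_lt_pow_left₀ hlt (by positivity) hMpos.ne'))

end

/-! ### Prefix sums of many linear orders -/

section

variable {Ω V κ : Type} [Fintype Ω] [DecidableEq V] [Fintype κ]

/-- A fibre has at most two points, so its squared sum is at most twice its size. -/
theorem sum_sq_sum_fiber_le {π : Ω → V} (hπ : ∀ v, #{x | π x = v} ≤ 2) {sgn : Ω → ℤ}
    (hsgn : ∀ x, |sgn x| ≤ 1) (S : Finset Ω) (W : Finset V) :
    ∑ v ∈ W, (∑ x ∈ S with π x = v, (sgn x : ℝ)) ^ 2 ≤ 2 * #S := by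
  classical
  have h1 : ∀ v ∈ W, (∑ x ∈ S with π x = v, (sgn x : ℝ)) ^ 2 ≤
      2 * (#{x ∈ S | π x = v} : ℕ) := by
    intro v _
    have h2 : |∑ x ∈ S with π x = v, (sgn x : ℝ)| ≤ (#{x ∈ S | π x = v} : ℕ) := by
      refine (abs_sum_le_sum_abs _ _).trans ?_
      rw [card_eq_sum_ones, Nat.cast_sum]
      refine sum_le_sum fun x _ => ?_
      simpa using (by exact_mod_cast hsgn x : |(sgn x : ℝ)| ≤ 1)
    have h3 : ((#{x ∈ S | π x = v} : ℕ) : ℝ) ≤ 2 := by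
      have : #{x ∈ S | π x = v} ≤ #{x | π x = v} :=
        card_le_card (filter_subset_filter _ (subset_univ S))
      exact_mod_cast this.trans (hπ v)
    rw [← sq_abs]
    have h0 := abs_nonneg (∑ x ∈ S with π x = v, (sgn x : ℝ))
    nlinarith
  refine (sum_le_sum h1).trans ?_
  rw [← mul_sum, ← Nat.cast_sum]
  gcongr
  rw [← card_biUnion]
  · exact card_le_card (biUnion_subset.2 fun v _ => filter_subset _ _)
  · intro v _ v' _ hvv'
    exact disjoint_filter.2 fun x _ h h' => hvv' (h.symm.trans h')

/-- The unknowns are indexed by `W`; a point `x` contributes `sgn x` to the coefficient of `π x`. -/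
theorem exists_partial_signed_coloring {π : Ω → V} (hπ : ∀ v, #{x | π x = v} ≤ 2)
    {sgn : Ω → ℤ} (hsgn : ∀ x, |sgn x| ≤ 1) (W : Finset V) (S : κ → Finset Ω)
    (hS : ∀ i, ∀ x ∈ S i, π x ∈ W) (D s : κ → ℝ) (hD : ∀ i, 0 < D i) (hs : ∀ i, 0 < s i)
    (hSs : ∀ i, 2 * (#(S i) : ℝ) ≤ s i) (hu : ∀ i, 8 ≤ D i ^ 2 / s i)
    (hsum : ∑ i, Real.exp (-(D i ^ 2 / s i / 8)) ≤ (#W : ℝ) / 60) :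
    ∃ ε : V → ℤ, (∀ v, ε v = 0 ∨ ε v = 1 ∨ ε v = -1) ∧ (∀ v, v ∉ W → ε v = 0) ∧
      #W ≤ 8 * #{v ∈ W | ε v ≠ 0} ∧ ∀ i, |∑ x ∈ S i, (sgn x : ℝ) * ε (π x)| ≤ D i := by
  obtain ⟨η, h1, h2, h3⟩ := exists_partial_coloring (ι := W)
    (fun i v => ∑ x ∈ S i with π x = (v : V), (sgn x : ℝ)) D s hD hs
    (fun i => by
      rw [sum_coe_sort W fun v => (∑ x ∈ S i with π x = v, (sgn x : ℝ)) ^ 2]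
      exact (sum_sq_sum_fiber_le hπ hsgn (S i) W).trans (hSs i)) hu (by simpa using hsum)
  set ε : V → ℤ := fun v => if h : v ∈ W then η ⟨v, h⟩ else 0 with hε
  have hεη : ∀ v : W, ε v = η v := fun v => by simp [hε]
  refine ⟨ε, fun v => ?_, fun v hv => by simp [hε, hv], ?_, fun i => ?_⟩
  · by_cases h : v ∈ W
    · rw [hεη ⟨v, h⟩]; exact h1 _
    · simp [hε, h]
  · have hc : #{v : W | η v ≠ 0} = #{v ∈ W | ε v ≠ 0} := by
      rw [← card_map (Function.Embedding.subtype _)]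
      congr 1
      ext v
      simp only [mem_map, mem_filter, mem_univ, true_and, Function.Embedding.subtype_apply]
      constructor
      · rintro ⟨w, hw, rfl⟩
        exact ⟨w.2, by rwa [hεη]⟩
      · rintro ⟨hv, hne⟩
        exact ⟨⟨v, hv⟩, by rwa [← hεη], rfl⟩
    rw [← hc]
    simpa using h2
  · have h4 : ∑ x ∈ S i, (sgn x : ℝ) * ε (π x) =
        ∑ v : W, (∑ x ∈ S i with π x = (v : V), (sgn x : ℝ)) * η v := by
      rw [← sum_fiberwise_of_maps_to (hS i), ← sum_coe_sort W]
      refine sum_congr rfl fun v _ => ?_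
      rw [sum_mul]
      refine sum_congr rfl fun x hx => ?_
      rw [(mem_filter.1 hx).2, hεη]
    rw [h4]
    exact h3 i

end

/-- The binary expansion of `T` splits its prefix into at most one aligned block of each size `2 ^
j`. -/
theorem abs_sub_le_sum_of_dyadic {G Δ : ℕ → ℝ} {m : ℕ} (hΔ : ∀ j, 0 ≤ Δ j)
    (h : ∀ j q, (q + 1) * 2 ^ j ≤ m → |G ((q + 1) * 2 ^ j) - G (q * 2 ^ j)| ≤ Δ j)
    {T : ℕ} (hT : T ≤ m) (J : ℕ) :
    |G T - G (T / 2 ^ J * 2 ^ J)| ≤ ∑ j ∈ range J, Δ j := by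
  induction J with
  | zero => simp
  | succ J ih =>
    rw [sum_range_succ]
    have hdiv : T / 2 ^ (J + 1) = T / 2 ^ J / 2 := by rw [pow_succ, Nat.div_div_eq_div_mul]
    have hle : T / 2 ^ J * 2 ^ J ≤ T := Nat.div_mul_le_self _ _
    set a := T / 2 ^ J with ha
    rw [hdiv]
    rcases Nat.even_or_odd' a with ⟨q, hq | hq⟩
    · have : a / 2 * 2 ^ (J + 1) = a * 2 ^ J := by
        rw [hq, Nat.mul_div_cancel_left _ two_pos]; ring
      rw [this]
      linarith [hΔ J]
    · have h1 : a / 2 * 2 ^ (J + 1) = (2 * q) * 2 ^ J := by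
        rw [show a / 2 = q by omega]; ring
      rw [h1]
      have h2 := h J (2 * q) (by rw [← hq]; exact hle.trans hT)
      rw [← hq] at h2
      have h3 := abs_sub_le (G T) (G (a * 2 ^ J)) (G (2 * q * 2 ^ J))
      linarith

section

variable {Ω : Type}

/-- The number of elements of `X` that precede `x` in the order given by `σ`. -/
def rankIn (X : Finset Ω) (σ : Ω → ℕ) (x : Ω) : ℕ := #{y ∈ X | σ y < σ x}

/-- Ranks close the gaps left by points outside `X`, so prefixes of `σ` become prefixes of
consecutive ranks. -/
theorem lt_iff_rankIn_lt {X : Finset Ω} {σ : Ω → ℕ} {x : Ω} (hx : x ∈ X) (t : ℕ) :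
    σ x < t ↔ rankIn X σ x < #{y ∈ X | σ y < t} := by
  constructor
  · intro h
    refine card_lt_card ((ssubset_iff_of_subset ?_).2 ⟨x, ?_, ?_⟩)
    · exact monotone_filter_right _ fun y _ (hy : σ y < σ x) => hy.trans h
    · simp [hx, h]
    · simp
  · intro h
    by_contra hlt
    refine absurd h (not_lt.2 (card_le_card ?_))
    exact monotone_filter_right _ fun y _ (hy : σ y < t) => lt_of_lt_of_le hy (not_lt.1 hlt)

theorem injOn_rankIn {X : Finset Ω} {σ : Ω → ℕ} (hσ : Function.Injective σ) :
    Set.InjOn (rankIn X σ) X := by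
  intro x hx y hy hxy
  by_contra hne
  rcases lt_or_gt_of_ne (hσ.ne hne) with h | h
  · exact ((lt_iff_rankIn_lt hx _).1 h).ne hxy
  · exact ((lt_iff_rankIn_lt hy _).1 h).ne hxy.symm

theorem card_rankIn_block_le {X : Finset Ω} {σ : Ω → ℕ} (hσ : Function.Injective σ) (j q : ℕ) :
    #{x ∈ X | rankIn X σ x / 2 ^ j = q} ≤ 2 ^ j := by
  have h : #{x ∈ X | rankIn X σ x / 2 ^ j = q} ≤ #(Ico (q * 2 ^ j) ((q + 1) * 2 ^ j)) := by
    refine card_le_card_of_injOn (rankIn X σ) ?_ ?_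
    · intro x hx
      have := (mem_filter.1 hx).2
      rw [Nat.div_eq_iff (by positivity)] at this
      simp only [coe_Ico, Set.mem_Ico]
      have h2 : 0 < 2 ^ j := by positivity
      rw [add_mul, one_mul]
      omega
    · exact (injOn_rankIn hσ).mono (coe_subset.2 (filter_subset _ _))
  refine h.trans ?_
  rw [Nat.card_Ico, add_mul]
  omega

theorem abs_sum_filter_lt_le {X : Finset Ω} {σ : Ω → ℕ} {f : Ω → ℝ}
    {Δ : ℕ → ℝ} (hΔ : ∀ j, 0 ≤ Δ j)
    (h : ∀ j, ∀ q < #X / 2 ^ j, |∑ x ∈ X with rankIn X σ x / 2 ^ j = q, f x| ≤ Δ j) (t : ℕ) :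
    |∑ x ∈ X with σ x < t, f x| ≤ ∑ j ∈ range (Nat.log 2 #X + 1), Δ j := by
  set G : ℕ → ℝ := fun T => ∑ x ∈ X with rankIn X σ x < T, f x with hG
  set T := #{y ∈ X | σ y < t} with hT
  have hTX : T ≤ #X := card_filter_le _ _
  have h1 : ∑ x ∈ X with σ x < t, f x = G T :=
    sum_congr (filter_congr fun x hx => lt_iff_rankIn_lt hx t) fun _ _ => rfl
  have hblock : ∀ j q, (q + 1) * 2 ^ j ≤ #X → |G ((q + 1) * 2 ^ j) - G (q * 2 ^ j)| ≤ Δ j := by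
    intro j q hq
    have h2 : G ((q + 1) * 2 ^ j) - G (q * 2 ^ j) =
        ∑ x ∈ X with rankIn X σ x / 2 ^ j = q, f x := by
      rw [sub_eq_iff_eq_add]
      simp only [hG, sum_filter]
      rw [← sum_add_distrib]
      refine sum_congr rfl fun x _ => ?_
      have hiff : ∀ c, rankIn X σ x < c * 2 ^ j ↔ rankIn X σ x / 2 ^ j < c := fun c =>
        (Nat.div_lt_iff_lt_mul (by positivity)).symm
      simp only [hiff]
      rcases lt_trichotomy (rankIn X σ x / 2 ^ j) q with hl | hl | hl
      · rw [if_pos (by omega), if_neg (by omega), if_pos hl, zero_add]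
      · rw [if_pos (by omega), if_pos hl, if_neg (by omega), add_zero]
      · rw [if_neg (by omega), if_neg (by omega), if_neg (by omega), add_zero]
    rw [h2]
    exact h j q ((Nat.lt_iff_add_one_le).2 ((Nat.le_div_iff_mul_le (by positivity)).2 hq))
  have h3 := abs_sub_le_sum_of_dyadic hΔ hblock hTX (Nat.log 2 #X + 1)
  rw [Nat.div_eq_of_lt (hTX.trans_lt (Nat.lt_pow_succ_log_self one_lt_two _))] at h3
  rw [h1]
  simpa [hG] using h3

end

theorem exp_neg_ten_mul_le {y : ℝ} (hy : 0 < y) :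
    Real.exp (-(10 * y)) ≤ 3 / 1250 / y ^ 4 := by
  -- The constant is 4! / 10 ^ 4 = 3 / 1250.
  have h := Real.pow_div_factorial_le_exp (10 * y) (by positivity) 4
  rw [Real.exp_neg, inv_le_comm₀ (Real.exp_pos _) (by positivity)]
  refine le_trans (le_of_eq ?_) h
  norm_num [Nat.factorial]
  field_simp
  norm_num

section

variable {Ω V I : Type} [Fintype Ω] [DecidableEq V] [Fintype I]

/-- Partial colouring is applied to all full dyadic rank blocks of all orders, a block of size `2 ^
j` being allowed discrepancy of order `(2 ^ j * N) ^ (1/4)`. The entropy sum is then a small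
multiple of `#W`, and the allowances grow geometrically, so the largest scale dominates. -/
theorem exists_partial_coloring_orders {π : Ω → V} (hπ : ∀ v, #{x | π x = v} ≤ 2)
    {sgn : Ω → ℤ} (hsgn : ∀ x, |sgn x| ≤ 1) {σ : I → Ω → ℕ}
    (hσ : ∀ i, Function.Injective (σ i)) {N : ℕ} (hΩ : Fintype.card Ω ≤ N) (hN : 0 < N)
    (hI : Fintype.card I ≤ N) {W : Finset V} (hW : W.Nonempty) :
    ∃ ε : V → ℤ, (∀ v, ε v = 0 ∨ ε v = 1 ∨ ε v = -1) ∧ (∀ v, v ∉ W → ε v = 0) ∧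
      #W ≤ 8 * #{v ∈ W | ε v ≠ 0} ∧
      ∀ i t, |∑ x with σ i x < t, (sgn x : ℝ) * ε (π x)| ≤
        √160 * (√√2 ^ 2 / (√√2 - 1)) * √√(#W * N) := by
  classical
  set X : Finset Ω := univ.filter fun x => π x ∈ W with hX
  have hXN : #X ≤ N := (card_le_univ X).trans hΩ
  have hXW : #X ≤ 2 * #W := by
    refine (card_le_mul_card_image_of_maps_to (f := π) (s := X)
      (fun x hx => (mem_filter.1 hx).2) 2 fun v _ =>
        (card_le_card (filter_subset_filter _ (subset_univ X))).trans (hπ v)).trans_eq ?_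
    ring
  set J := Nat.log 2 #X + 1 with hJ
  have hNr : (0 : ℝ) < N := by exact_mod_cast hN
  set Δ : ℕ → ℝ := fun j => √160 * √√(2 ^ j * N) with hΔdef
  have hΔpos : ∀ j, 0 < Δ j := fun j => by positivity
  have hratio : ∀ j : ℕ, Δ j ^ 2 / (2 * 2 ^ j) / 8 = 10 * √(N / 2 ^ j) := by
    intro j
    have h1 : √((2 : ℝ) ^ j * N) = 2 ^ j * √(N / 2 ^ j) := by
      rw [show (2 : ℝ) ^ j * N = (2 ^ j) ^ 2 * (N / 2 ^ j) by field_simp,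
        Real.sqrt_mul (by positivity), Real.sqrt_sq (by positivity)]
    simp only [hΔdef]
    rw [mul_pow, Real.sq_sqrt (by norm_num), Real.sq_sqrt (by positivity), h1]
    field_simp
    norm_num
  have hpowJ : ∀ m : ℕ, 0 < m → #X ≤ m → 2 ^ Nat.log 2 #X ≤ m := fun m hm hle =>
    (Nat.pow_le_pow_right two_pos (Nat.log_mono_right hle)).trans (Nat.pow_log_le_self 2 hm.ne')
  obtain ⟨ε, h1, h2, h3, h4⟩ := exists_partial_signed_coloring
    (κ := I × Σ j : Fin J, Fin (#X / 2 ^ (j : ℕ))) hπ hsgn W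
    (fun b => {x ∈ X | rankIn X (σ b.1) x / 2 ^ (b.2.1 : ℕ) = (b.2.2 : ℕ)})
    (fun b x hx => (mem_filter.1 (mem_filter.1 hx).1).2)
    (fun b => Δ b.2.1) (fun b => 2 * 2 ^ (b.2.1 : ℕ)) (fun b => hΔpos _)
    (fun b => by positivity)
    (fun b => by
      have := card_rankIn_block_le (X := X) (hσ b.1) b.2.1 b.2.2
      gcongr
      exact_mod_cast this)
    (fun b => by
      have hb : 0 < #X / 2 ^ (b.2.1 : ℕ) := b.2.2.pos
      have hle : 2 ^ (b.2.1 : ℕ) ≤ N :=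
        ((Nat.div_pos_iff.1 hb).2).trans hXN
      have hle' : (2 : ℝ) ^ (b.2.1 : ℕ) ≤ N := by exact_mod_cast hle
      have h1 : 1 ≤ √((N : ℝ) / 2 ^ (b.2.1 : ℕ)) := by
        rw [Real.one_le_sqrt, one_le_div (by positivity)]
        exact hle'
      have := hratio b.2.1
      linarith)
    (by
      simp only [hratio]
      rw [Fintype.sum_prod_type]
      dsimp only
      rw [sum_const, card_univ, nsmul_eq_mul, Fintype.sum_sigma]
      simp only [sum_const, card_univ, Fintype.card_fin, nsmul_eq_mul]
      have hterm : ∀ j : Fin J, ((#X / 2 ^ (j : ℕ) : ℕ) : ℝ) *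
          Real.exp (-(10 * √((N : ℝ) / 2 ^ (j : ℕ)))) ≤
          (3 / 625 * #W / (N : ℝ) ^ 2) * 2 ^ (j : ℕ) := by
        intro j
        have ha : ((#X / 2 ^ (j : ℕ) : ℕ) : ℝ) ≤ 2 * #W / 2 ^ (j : ℕ) := by
          refine Nat.cast_div_le.trans ?_
          push_cast
          gcongr
          exact_mod_cast hXW
        have hb := exp_neg_ten_mul_le (y := √((N : ℝ) / 2 ^ (j : ℕ))) (by positivity)
        have hc : √((N : ℝ) / 2 ^ (j : ℕ)) ^ 4 = ((N : ℝ) / 2 ^ (j : ℕ)) ^ 2 := by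
          rw [show 4 = 2 * 2 by norm_num, pow_mul, Real.sq_sqrt (by positivity)]
        rw [hc] at hb
        calc _ ≤ 2 * (#W : ℝ) / 2 ^ (j : ℕ) * (3 / 1250 / ((N : ℝ) / 2 ^ (j : ℕ)) ^ 2) := by
              gcongr
          _ = _ := by field_simp; norm_num
      have hsum : ∑ j : Fin J, (2 : ℝ) ^ (j : ℕ) ≤ 2 * N := by
        rw [Fin.sum_univ_eq_sum_range fun j => (2 : ℝ) ^ j, geom_sum_eq (by norm_num), hJ,
          pow_succ]
        have := hpowJ N hN hXN
        have h' : (2 : ℝ) ^ Nat.log 2 #X ≤ N := by exact_mod_cast this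
        norm_num
        linarith
      calc _ ≤ (N : ℝ) * ∑ j : Fin J, (3 / 625 * #W / (N : ℝ) ^ 2) * 2 ^ (j : ℕ) := by
            refine mul_le_mul (Nat.cast_le.2 hI) (sum_le_sum fun j _ => hterm j)
              (sum_nonneg fun j _ => by positivity) hNr.le
        _ = (N : ℝ) * ((3 / 625 * #W / (N : ℝ) ^ 2) * ∑ j : Fin J, (2 : ℝ) ^ (j : ℕ)) := by
            rw [← mul_sum univ]
        _ ≤ (N : ℝ) * ((3 / 625 * #W / (N : ℝ) ^ 2) * (2 * N)) := by gcongr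
        _ = 6 / 625 * #W := by field_simp; norm_num
        _ ≤ _ := by linarith [(Nat.cast_nonneg #W : (0 : ℝ) ≤ #W)])
  refine ⟨ε, h1, h2, h3, fun i t => ?_⟩
  have hres : ∑ x with σ i x < t, (sgn x : ℝ) * ε (π x) =
      ∑ x ∈ X with σ i x < t, (sgn x : ℝ) * ε (π x) := by
    symm
    refine sum_subset (filter_subset_filter _ (subset_univ X)) fun x hx hx' => ?_
    have : π x ∉ W := fun hw => hx' (by
      simp only [mem_filter, mem_univ, true_and, hX] at hx ⊢
      exact ⟨hw, hx⟩)
    rw [h2 _ this]; simp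
  rw [hres]
  have hblocks : ∀ j, ∀ q < #X / 2 ^ j, |∑ x ∈ X with rankIn X (σ i) x / 2 ^ j = q,
      (sgn x : ℝ) * ε (π x)| ≤ Δ j := by
    intro j q hq
    have hjJ : j < J := by
      have h5 : 2 ^ j ≤ #X := (Nat.div_pos_iff.1 (by omega)).2
      exact Nat.lt_succ_of_le (Nat.le_log_of_pow_le one_lt_two h5)
    exact h4 (i, ⟨⟨j, hjJ⟩, ⟨q, hq⟩⟩)
  refine (abs_sum_filter_lt_le (fun j => (hΔpos j).le) hblocks t).trans ?_
  have hρ : 1 < √√(2 : ℝ) := by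
    rw [Real.lt_sqrt zero_le_one, Real.lt_sqrt (by norm_num)]; norm_num
  have hsq : ∀ j : ℕ, √√((2 : ℝ) ^ j) = √√2 ^ j := fun j => by
    induction j with
    | zero => simp
    | succ j ih => rw [pow_succ, Real.sqrt_mul (by positivity), Real.sqrt_mul (by positivity), ih,
        pow_succ]
  have hΔ2 : ∀ j, Δ j = √160 * √√N * √√2 ^ j := fun j => by
    simp only [hΔdef]
    rw [Real.sqrt_mul (by positivity), Real.sqrt_mul (by positivity), hsq]
    ring
  simp only [hΔ2]
  rw [← mul_sum, geom_sum_eq hρ.ne']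
  -- The largest block size is at most `2 * #W`, since each pair has at most two points.
  have hlog : √√(2 : ℝ) ^ Nat.log 2 #X ≤ √√2 * √√(#W : ℝ) := by
    rw [← hsq, ← Real.sqrt_mul (by positivity), ← Real.sqrt_mul (by positivity)]
    refine Real.sqrt_le_sqrt (Real.sqrt_le_sqrt ?_)
    exact_mod_cast hpowJ (2 * #W) (by have := hW.card_pos; omega) hXW
  have hWN : √√((#W : ℝ) * N) = √√(#W : ℝ) * √√N := by
    rw [Real.sqrt_mul (by positivity), Real.sqrt_mul (by positivity)]
  rw [hWN]
  have hρ0 : 0 < √√(2 : ℝ) - 1 := by linarith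
  calc √160 * √√N * ((√√2 ^ (Nat.log 2 #X + 1) - 1) / (√√2 - 1))
      ≤ √160 * √√N * ((√√2 * √√(#W : ℝ)) * √√2 / (√√2 - 1)) := by
        rw [pow_succ]
        gcongr
        have : √√(2 : ℝ) ^ Nat.log 2 #X * √√2 ≤ √√2 * √√(#W : ℝ) * √√2 := by gcongr
        linarith
    _ = _ := by ring

/-- Each round colours at least an eighth of `W`, so the successive bounds decay with ratio `(7/8) ^
(1/4)` and their sum converges. -/
theorem exists_coloring_orders_on {π : Ω → V} (hπ : ∀ v, #{x | π x = v} ≤ 2)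
    {sgn : Ω → ℤ} (hsgn : ∀ x, |sgn x| ≤ 1) {σ : I → Ω → ℕ}
    (hσ : ∀ i, Function.Injective (σ i)) {N : ℕ} (hΩ : Fintype.card Ω ≤ N) (hN : 0 < N)
    (hI : Fintype.card I ≤ N) (W : Finset V) :
    ∃ ε : V → ℤ, (∀ v ∈ W, ε v = 1 ∨ ε v = -1) ∧ (∀ v, v ∉ W → ε v = 0) ∧
      ∀ i t, |∑ x with σ i x < t, (sgn x : ℝ) * ε (π x)| ≤
        √160 * (√√2 ^ 2 / (√√2 - 1)) / (1 - √√(7 / 8)) * √√(#W * N) := by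
  induction W using Finset.strongInduction with
  | H W ih =>
  have hρ : 1 < √√(2 : ℝ) := by
    rw [Real.lt_sqrt zero_le_one, Real.lt_sqrt (by norm_num)]; norm_num
  have hτ : √√(7 / 8 : ℝ) < 1 := by
    rw [Real.sqrt_lt' one_pos, Real.sqrt_lt' (by norm_num)]; norm_num
  have hρ0 : 0 < √√(2 : ℝ) - 1 := by linarith
  have hτ0 : 0 < 1 - √√(7 / 8 : ℝ) := by linarith
  set C : ℝ := √160 * (√√2 ^ 2 / (√√2 - 1)) with hC
  have hC0 : 0 ≤ C := by positivity
  rcases W.eq_empty_or_nonempty with rfl | hW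
  · exact ⟨fun _ => 0, by simp, by simp, fun i t => by simp⟩
  obtain ⟨ε, h1, h2, h3, h4⟩ := exists_partial_coloring_orders hπ hsgn hσ hΩ hN hI hW
  set W' := W.filter fun v => ε v = 0 with hW'
  have hcard : #W' + #{v ∈ W | ε v ≠ 0} = #W := card_filter_add_card_filter_not _
  have hlt : W' ⊂ W := by
    refine (filter_subset _ _).ssubset_of_ne fun h => ?_
    have h5 : #W' = #W := congrArg card h
    have := hW.card_pos
    omega
  obtain ⟨η, g1, g2, g3⟩ := ih W' hlt
  refine ⟨fun v => ε v + η v, fun v hv => ?_, fun v hv => ?_, fun i t => ?_⟩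
  · by_cases h0 : ε v = 0
    · simpa [h0] using g1 v (mem_filter.2 ⟨hv, h0⟩)
    · have : η v = 0 := g2 v fun h => h0 (mem_filter.1 h).2
      simpa [this, h0] using h1 v
  · simp [h2 v hv, g2 v fun h => hv (mem_filter.1 h).1]
  · have hsplit : ∑ x with σ i x < t, (sgn x : ℝ) * ((ε (π x) + η (π x) : ℤ) : ℝ) =
        ∑ x with σ i x < t, (sgn x : ℝ) * ε (π x) +
          ∑ x with σ i x < t, (sgn x : ℝ) * η (π x) := by
      rw [← sum_add_distrib]
      refine sum_congr rfl fun x _ => ?_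
      push_cast
      ring
    rw [hsplit]
    refine (abs_add_le _ _).trans ((add_le_add (h4 i t) (g3 i t)).trans ?_)
    have hWc : (#W' : ℝ) * N ≤ 7 / 8 * (#W * N) := by
      have h5 : 8 * #W' ≤ 7 * #W := by omega
      have h6 : (8 : ℝ) * #W' ≤ 7 * #W := by exact_mod_cast h5
      have h7 : (0 : ℝ) ≤ N := by positivity
      nlinarith
    have hroot : √√((#W' : ℝ) * N) ≤ √√(7 / 8) * √√(#W * N) := by
      rw [← Real.sqrt_mul (by positivity), ← Real.sqrt_mul (by positivity)]
      exact Real.sqrt_le_sqrt (Real.sqrt_le_sqrt hWc)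
    calc C * √√(#W * N) + C / (1 - √√(7 / 8)) * √√(#W' * N)
        ≤ C * √√(#W * N) + C / (1 - √√(7 / 8)) * (√√(7 / 8) * √√(#W * N)) := by gcongr
      _ = _ := by field_simp; ring

end

/-! ### Digit reversal and balanced cosets -/

/-- The reversal of the `K` lowest base-`p` digits of a natural number. -/
def digitRev (p : ℕ) : ℕ → ℕ → ℕ
  | 0, _ => 0
  | K + 1, x => (x % p) * p ^ K + digitRev p K (x / p)

theorem digitRev_lt {p : ℕ} (hp : 0 < p) (K x : ℕ) : digitRev p K x < p ^ K := by
  induction K generalizing x with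
  | zero => simp [digitRev]
  | succ K ih =>
    have h1 := ih (x / p)
    have h2 : x % p + 1 ≤ p := Nat.mod_lt x hp
    calc digitRev p (K + 1) x < (x % p + 1) * p ^ K := by rw [digitRev]; linarith
      _ ≤ p * p ^ K := Nat.mul_le_mul_right _ h2
      _ = p ^ (K + 1) := by ring

theorem digitRev_div {p : ℕ} (hp : 0 < p) (w j x : ℕ) :
    digitRev p (w + j) x / p ^ j = digitRev p w x := by
  induction w generalizing x with
  | zero => simpa [digitRev] using Nat.div_eq_of_lt (digitRev_lt hp j x)
  | succ w ih =>
    rw [show w + 1 + j = (w + j) + 1 by ring, digitRev, digitRev, ← ih (x / p), pow_add,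
      ← mul_assoc, add_comm, Nat.add_mul_div_right _ _ (pow_pos hp j), add_comm]

theorem digitRev_eq_iff {p : ℕ} (hp : 0 < p) (w x y : ℕ) :
    digitRev p w x = digitRev p w y ↔ x % p ^ w = y % p ^ w := by
  induction w generalizing x y with
  | zero => simp [digitRev, Nat.mod_one]
  | succ w ih =>
    have h1 : ∀ z, digitRev p (w + 1) z / p ^ w = z % p ∧
        digitRev p (w + 1) z % p ^ w = digitRev p w (z / p) := fun z => by
      have := digitRev_lt hp w (z / p)
      rw [digitRev, add_comm]
      exact ⟨by rw [Nat.add_mul_div_right _ _ (pow_pos hp w), Nat.div_eq_of_lt this, zero_add],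
        by rw [Nat.add_mul_mod_self_right, Nat.mod_eq_of_lt this]⟩
    have h2 : ∀ z, z % p ^ (w + 1) % p = z % p ∧ z % p ^ (w + 1) / p = z / p % p ^ w := fun z => by
      rw [pow_succ', Nat.mod_mul, add_comm]
      exact ⟨by rw [Nat.mul_add_mod, Nat.mod_mod],
        by rw [Nat.mul_add_div hp, Nat.div_eq_of_lt (Nat.mod_lt z hp), add_zero]⟩
    constructor
    · intro h
      have ha : x % p = y % p := by rw [← (h1 x).1, ← (h1 y).1, h]
      have hb : x / p % p ^ w = y / p % p ^ w := by
        rw [← ih, ← (h1 x).2, ← (h1 y).2, h]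
      rw [pow_succ', Nat.mod_mul, Nat.mod_mul, ha, hb]
    · intro h
      have ha : x % p = y % p := by rw [← (h2 x).1, ← (h2 y).1, h]
      have hb : x / p % p ^ w = y / p % p ^ w := by rw [← (h2 x).2, ← (h2 y).2, h]
      rw [digitRev, digitRev, ha, (ih _ _).2 hb]

section

variable {p K : ℕ} [NeZero (p ^ K)]

theorem injective_digitRev_val (hp : 0 < p) :
    Function.Injective fun x : ZMod (p ^ K) => digitRev p K x.val := by
  intro x y hxy
  have h := (digitRev_eq_iff hp K _ _).1 hxy
  rw [Nat.mod_eq_of_lt (ZMod.val_lt x), Nat.mod_eq_of_lt (ZMod.val_lt y)] at h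
  exact ZMod.val_injective _ h

theorem image_digitRev_val (hp : 0 < p) :
    univ.image (fun x : ZMod (p ^ K) => digitRev p K x.val) = range (p ^ K) := by
  refine eq_of_subset_of_card_le ?_ ?_
  · intro r hr
    obtain ⟨x, -, rfl⟩ := mem_image.1 hr
    exact mem_range.2 (digitRev_lt hp K _)
  · rw [card_image_of_injective _ (injective_digitRev_val hp), card_univ, ZMod.card, card_range]

theorem sum_digitRev_block {M : Type*} [AddCommMonoid M] (hp : 0 < p) {w j : ℕ} (hK : w + j = K)
    {c : ℕ} (hc : c < p ^ w) (h : ℕ → M) :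
    ∑ x : ZMod (p ^ K) with digitRev p K x.val / p ^ j = c, h (digitRev p K x.val) =
      ∑ r ∈ Ico (c * p ^ j) ((c + 1) * p ^ j), h r := by
  have hset : Ico (c * p ^ j) ((c + 1) * p ^ j) = {r ∈ range (p ^ K) | r / p ^ j = c} := by
    ext r
    rw [mem_Ico, mem_filter, mem_range, Nat.div_eq_iff (pow_pos hp j)]
    have h1 : (c + 1) * p ^ j ≤ p ^ K := by
      rw [← hK, pow_add]; exact Nat.mul_le_mul_right _ hc
    have h2 := pow_pos hp j
    have h3 : (c + 1) * p ^ j = c * p ^ j + p ^ j := by ring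
    omega
  rw [hset, sum_filter, sum_filter, ← image_digitRev_val hp,
    sum_image (injective_digitRev_val hp).injOn]

/-- The orbit is a residue class modulo `p ^ w`, where `p ^ w` is the gcd of `d.val` and the
modulus. Its members share their `w` lowest digits, which reversal makes the leading ones. -/
theorem image_orbit_eq (hp : p.Prime) (a d : ZMod (p ^ K)) :
    ∃ w j c, w + j = K ∧ c < p ^ w ∧
      (range (addOrderOf d)).image (fun s : ℕ => a + s * d) =
        univ.filter fun x : ZMod (p ^ K) => digitRev p K x.val / p ^ j = c := by
  obtain ⟨w, hw, hg⟩ := (Nat.dvd_prime_pow hp).1 (Nat.gcd_dvd_left (p ^ K) d.val)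
  obtain ⟨j, rfl⟩ := Nat.exists_eq_add_of_le hw
  have hord : addOrderOf d = p ^ j := by
    rw [← ZMod.natCast_zmod_val d, ZMod.addOrderOf_coe _ (NeZero.ne _), hg, pow_add,
      Nat.mul_div_cancel_left _ (pow_pos hp.pos w)]
  have hpd : p ^ w ∣ d.val := hg ▸ Nat.gcd_dvd_right _ _
  refine ⟨w, j, digitRev p w a.val, rfl, digitRev_lt hp.pos _ _, ?_⟩
  refine eq_of_subset_of_card_le ?_ ?_
  · intro x hx
    obtain ⟨s, -, rfl⟩ := mem_image.1 hx
    rw [mem_filter]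
    refine ⟨mem_univ _, ?_⟩
    rw [digitRev_div hp.pos, digitRev_eq_iff hp.pos]
    have : a + s * d = ((a.val + s * d.val : ℕ) : ZMod (p ^ (w + j))) := by
      push_cast
      rw [ZMod.natCast_zmod_val, ZMod.natCast_zmod_val]
    rw [this, ZMod.val_natCast, Nat.mod_mod_of_dvd _ (pow_dvd_pow _ hw)]
    obtain ⟨e, he⟩ := hpd
    rw [he, mul_left_comm, Nat.add_mul_mod_self_left]
  · rw [card_image_of_injOn]
    · have h1 := sum_digitRev_block (K := w + j) hp.pos rfl (digitRev_lt hp.pos w a.val) fun _ => 1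
      simp only [sum_const, smul_eq_mul, mul_one, Nat.card_Ico] at h1
      rw [h1, card_range, hord, add_mul, one_mul, Nat.add_sub_cancel_left]
    · intro s hs t ht hst
      simp only [coe_range, Set.mem_Iio] at hs ht
      have h2 : s • d = t • d := by simpa using hst
      exact nsmul_injOn_Iio_addOrderOf hs ht h2

/-- Neighbours `2v` and `2v + 1` cancel; at most one term is left unpaired. -/
theorem abs_sum_alternating_le {ε : ℕ → ℤ} {N : ℕ} (hε : ∀ v < N, |ε v| ≤ 1) {t : ℕ}
    (ht : t ≤ N) : |∑ r ∈ range t, (-1) ^ r * ε (r / 2)| ≤ 1 := by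
  have heven : ∀ s, ∑ r ∈ range (2 * s), (-1) ^ r * ε (r / 2) = 0 := fun s => by
    induction s with
    | zero => simp
    | succ s ih =>
      rw [show 2 * (s + 1) = 2 * s + 1 + 1 by ring, sum_range_succ, sum_range_succ, ih,
        show (2 * s + 1) / 2 = s by omega, show 2 * s / 2 = s by omega, pow_succ, pow_mul]
      simp
  rcases Nat.even_or_odd' t with ⟨s, rfl | rfl⟩
  · simp [heven]
  · rw [sum_range_succ, heven, show 2 * s / 2 = s by omega, pow_mul]
    simpa using hε s (by omega)

theorem abs_sum_orbit_le (hp : p.Prime) {ε : ℕ → ℤ} (hε : ∀ v < p ^ K, |ε v| ≤ 1)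
    (a d : ZMod (p ^ K)) :
    |∑ s ∈ range (addOrderOf d), (-1) ^ digitRev p K (a + s * d).val *
      ε (digitRev p K (a + s * d).val / 2)| ≤ 2 := by
  obtain ⟨w, j, c, hK, hc, himg⟩ := image_orbit_eq hp a d
  have h1 : ∑ s ∈ range (addOrderOf d), (-1) ^ digitRev p K (a + s * d).val *
      ε (digitRev p K (a + s * d).val / 2) =
      ∑ r ∈ Ico (c * p ^ j) ((c + 1) * p ^ j), (-1) ^ r * ε (r / 2) := by
    rw [← sum_digitRev_block hp.pos hK hc fun r => (-1) ^ r * ε (r / 2), ← himg, sum_image]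
    intro s hs t ht hst
    simp only [coe_range, Set.mem_Iio] at hs ht
    have h2 : s • d = t • d := by simpa using hst
    exact nsmul_injOn_Iio_addOrderOf hs ht h2
  have h3 : (c + 1) * p ^ j ≤ p ^ K := by
    rw [← hK, pow_add]; exact Nat.mul_le_mul_right _ hc
  have h4 : c * p ^ j ≤ (c + 1) * p ^ j := Nat.mul_le_mul_right _ (Nat.le_succ c)
  rw [h1, sum_Ico_eq_sub _ h4]
  refine (abs_sub _ _).trans ?_
  have h5 := abs_sum_alternating_le hε h3
  have h6 := abs_sum_alternating_le hε (h4.trans h3)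
  linarith

end

/-- The cosets of the cyclic subgroup generated by `d` can be laid out one after the other, each
of them in the order in which translation by `d` runs through it. -/
theorem exists_orbit_order {G : Type*} [AddCommGroup G] [Finite G] (d : G) :
    ∃ σ : G → ℕ, Function.Injective σ ∧ ∀ a, ∃ b A, ∃ j < addOrderOf d, a = b + j • d ∧
      ∀ s < addOrderOf d, σ (b + s • d) = A + s := by
  classical
  set H := AddSubgroup.zmultiples d
  set o := addOrderOf d with ho
  have hrep : ∀ x : G, ∃ j < o, x = ((x : G ⧸ H).out : G) + j • d := by
    intro x
    have h1 : -((x : G ⧸ H).out : G) + x ∈ H := by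
      rw [← QuotientAddGroup.eq, QuotientAddGroup.out_eq']
    rw [mem_zmultiples_iff_mem_range_addOrderOf] at h1
    obtain ⟨j, hj, hjx⟩ := mem_image.1 h1
    refine ⟨j, mem_range.1 hj, ?_⟩
    have h2 : j • d = -((x : G ⧸ H).out : G) + x := hjx
    rw [h2]; abel
  choose J hJ hJx using hrep
  obtain ⟨c⟩ : Nonempty (G ⧸ H ≃ Fin (Nat.card (G ⧸ H))) := ⟨Finite.equivFin _⟩
  have hopos : 0 < o := addOrderOf_pos d
  refine ⟨fun x => (c (x : G ⧸ H) : ℕ) * o + J x, ?_, ?_⟩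
  · intro x y hxy
    have hxy' : (c (x : G ⧸ H) : ℕ) * o + J x = (c (y : G ⧸ H) : ℕ) * o + J y := hxy
    have h1 : (c (x : G ⧸ H) : ℕ) = c (y : G ⧸ H) := by
      have := congrArg (· / o) hxy'
      simpa [add_comm _ (J _), Nat.add_mul_div_right _ _ hopos, Nat.div_eq_of_lt (hJ _)] using this
    have h2 : J x = J y := by rw [h1] at hxy'; omega
    have h3 : (x : G ⧸ H) = y := c.injective (Fin.ext h1)
    rw [hJx x, hJx y, h2, h3]
  · intro a
    refine ⟨(a : G ⧸ H).out, (c (a : G ⧸ H) : ℕ) * o, J a, hJ a, hJx a, fun s hs => ?_⟩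
    have h1 : (((a : G ⧸ H).out + s • d : G) : G ⧸ H) = a := by
      rw [QuotientAddGroup.mk_add_of_mem _ (AddSubgroup.nsmul_mem_zmultiples d s),
        QuotientAddGroup.out_eq']
    have h2 := hJx ((a : G ⧸ H).out + s • d)
    rw [h1] at h2
    have h3 := nsmul_injOn_Iio_addOrderOf (Set.mem_Iio.2 hs)
      (Set.mem_Iio.2 (hJ ((a : G ⧸ H).out + s • d))) (add_left_cancel h2)
    dsimp only
    rw [h1, ← h3]

/-! ### Colouring ℤ/p^K -/

theorem abs_sum_orbit_prefix_le {n : ℕ} [NeZero n] {f : ZMod n → ℝ} {b d : ZMod n} {S B : ℝ}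
    (hfull : |∑ s ∈ range (addOrderOf d), f (b + s * d)| ≤ S)
    (hpart : ∀ t < addOrderOf d, |∑ s ∈ range t, f (b + s * d)| ≤ B) (t : ℕ) :
    |∑ s ∈ range t, f (b + s * d)| ≤ (t / addOrderOf d : ℕ) * S + B := by
  set o := addOrderOf d with ho
  have hopos : 0 < o := addOrderOf_pos d
  have hod : (o : ZMod n) * d = 0 := by rw [← nsmul_eq_mul, ho, addOrderOf_nsmul_eq_zero]
  have hper : ∀ q u, ∑ s ∈ range (q * o + u), f (b + s * d) =
      q * ∑ s ∈ range o, f (b + s * d) + ∑ s ∈ range u, f (b + s * d) := by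
    intro q u
    induction q with
    | zero => simp
    | succ q ih =>
      rw [show (q + 1) * o + u = o + (q * o + u) by ring, sum_range_add]
      have h1 : ∀ s : ℕ, b + ((o + s : ℕ) : ZMod n) * d = b + s * d := fun s => by
        push_cast
        rw [add_mul, hod, zero_add]
      simp only [h1]
      rw [ih]
      push_cast
      ring
  have h2 := hper (t / o) (t % o)
  rw [mul_comm (t / o) o, Nat.div_add_mod] at h2
  rw [h2]
  refine (abs_add_le _ _).trans (add_le_add ?_ (hpart _ (Nat.mod_lt _ hopos)))
  rw [abs_mul, Nat.abs_cast]
  gcongr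

theorem exists_coloring_zmod_prime_pow : ∃ C : ℝ, 0 ≤ C ∧ ∀ (p K : ℕ) [NeZero (p ^ K)], p.Prime →
    ∃ φ : ZMod (p ^ K) → ℤˣ, ∀ (a d : ZMod (p ^ K)) (l : ℕ),
      |∑ s ∈ range l, ((φ (a + s * d) : ℤ) : ℝ)| ≤
        2 * (l / addOrderOf d : ℕ) + 2 + C * √((p : ℝ) ^ K) := by
  have hρ : 1 < √√(2 : ℝ) := by
    rw [Real.lt_sqrt zero_le_one, Real.lt_sqrt (by norm_num)]; norm_num
  have hτ : √√(7 / 8 : ℝ) < 1 := by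
    rw [Real.sqrt_lt' one_pos, Real.sqrt_lt' (by norm_num)]; norm_num
  have hρ0 : 0 < √√(2 : ℝ) - 1 := by linarith
  have hτ0 : 0 < 1 - √√(7 / 8 : ℝ) := by linarith
  obtain ⟨C, hC⟩ : ∃ C, C = √160 * (√√2 ^ 2 / (√√2 - 1)) / (1 - √√(7 / 8)) := ⟨_, rfl⟩
  have hC0 : 0 ≤ C := by rw [hC]; positivity
  refine ⟨4 * C, by positivity, fun p K _ hp => ?_⟩
  have hN : 0 < p ^ K := pow_pos hp.pos K
  choose σ hσ horb using fun d : ZMod (p ^ K) => exists_orbit_order d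
  set rev : ZMod (p ^ K) → ℕ := fun x => digitRev p K x.val with hrev
  have hrevinj : Function.Injective rev := injective_digitRev_val hp.pos
  obtain ⟨ε, h1, -, h2⟩ := exists_coloring_orders_on (π := fun x => rev x / 2)
    (sgn := fun x => (-1) ^ rev x) (σ := σ) (N := p ^ K)
    (fun v => by
      refine (card_le_card_of_injOn (t := {2 * v, 2 * v + 1}) rev ?_ hrevinj.injOn).trans
        card_le_two
      intro x hx
      have : rev x / 2 = v := by simpa using hx
      simp only [coe_insert, coe_singleton, Set.mem_insert_iff, Set.mem_singleton_iff]
      omega)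
    (fun x => by simp) hσ (by simp [ZMod.card]) hN (by simp [ZMod.card]) (range (p ^ K))
  rw [← hC, card_range] at h2
  have hroot : √√(((p ^ K : ℕ) : ℝ) * ((p ^ K : ℕ) : ℝ)) = √((p : ℝ) ^ K) := by
    rw [Real.sqrt_mul_self (by positivity)]
    push_cast
    rfl
  rw [hroot] at h2
  set B := C * √((p : ℝ) ^ K) with hB
  have hB0 : 0 ≤ B := by positivity
  have hunit : ∀ x, IsUnit ((-1) ^ rev x * ε (rev x / 2)) := fun x => by
    refine IsUnit.mul (IsUnit.pow _ (by simp)) (Int.isUnit_iff.2 (h1 _ (mem_range.2 ?_)))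
    exact (Nat.div_le_self _ _).trans_lt (digitRev_lt hp.pos K _)
  set φ : ZMod (p ^ K) → ℤˣ := fun x => (hunit x).unit with hφ
  set f : ZMod (p ^ K) → ℝ := fun x => ((φ x : ℤ) : ℝ) with hf
  have hφf : ∀ x, f x = (((-1) ^ rev x : ℤ) : ℝ) * (ε (rev x / 2) : ℝ) := fun x => by
    simp [hf, hφ]
  refine ⟨φ, fun a d l => ?_⟩
  have hfull : ∀ b, |∑ s ∈ range (addOrderOf d), f (b + s * d)| ≤ 2 := fun b => by
    have h3 := abs_sum_orbit_le hp (ε := ε) (fun v hv => by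
      rcases h1 v (mem_range.2 hv) with h | h <;> simp [h]) b d
    simp only [hφf]
    exact_mod_cast h3
  obtain ⟨b, A, j, hj, rfl, hbA⟩ := horb d a
  have hpart : ∀ t < addOrderOf d, |∑ s ∈ range t, f (b + s * d)| ≤ 2 * B := by
    intro t ht
    -- A partial orbit from `b` occupies the positions `A, …, A + t - 1` of the order for `d`, so it
    -- is a difference of two prefixes.
    have h3 : ∑ s ∈ range t, f (b + s * d) =
        ∑ x with σ d x < A + t, f x - ∑ x with σ d x < A, f x := by
      rw [eq_sub_iff_add_eq, ← sum_image (g := fun s : ℕ => b + s * d) (f := f), ← sum_union]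
      · refine sum_congr ?_ fun _ _ => rfl
        ext x
        simp only [mem_union, mem_image, mem_range, mem_filter, mem_univ, true_and]
        constructor
        · rintro (⟨s, hs, rfl⟩ | hx)
          · rw [← nsmul_eq_mul, hbA s (hs.trans ht)]; omega
          · omega
        · intro hx
          by_cases hxA : σ d x < A
          · exact Or.inr hxA
          · refine Or.inl ⟨σ d x - A, by omega, hσ d ?_⟩
            rw [← nsmul_eq_mul, hbA _ (by omega)]; omega
      · rw [disjoint_left]
        intro x hx hx'
        obtain ⟨s, hs, rfl⟩ := mem_image.1 hx
        have := (mem_filter.1 hx').2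
        rw [← nsmul_eq_mul, hbA s ((mem_range.1 hs).trans ht)] at this
        omega
      · intro s hs s' hs' hss
        simp only [coe_range, Set.mem_Iio] at hs hs'
        have h4 : s • d = s' • d := by simpa using hss
        exact nsmul_injOn_Iio_addOrderOf (hs.trans ht) (hs'.trans ht) h4
    rw [h3]
    refine (abs_sub _ _).trans ?_
    have h4 := h2 d (A + t)
    have h5 := h2 d A
    simp only [← hφf] at h4 h5
    linarith
  -- The progression starts `j` steps into the orbit laid out from `b`. Starting late costs at most
  -- one extra turn and one more partial orbit, whence the `+ 2` and `4 * C`.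
  have hsum : ∑ s ∈ range l, f (b + j • d + s * d) =
      ∑ s ∈ range (j + l), f (b + s * d) - ∑ s ∈ range j, f (b + s * d) := by
    rw [sum_range_add, add_sub_cancel_left]
    refine sum_congr rfl fun s _ => ?_
    congr 1
    rw [nsmul_eq_mul]
    push_cast
    ring
  change |∑ s ∈ range l, f (b + j • d + s * d)| ≤ _
  rw [hsum]
  refine (abs_sub _ _).trans ?_
  have h6 := abs_sum_orbit_prefix_le (hfull b) hpart (j + l)
  have h7 := hpart j hj
  have h8 : (j + l) / addOrderOf d ≤ l / addOrderOf d + 1 := by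
    have hopos := addOrderOf_pos d
    rw [← Nat.add_div_right _ hopos]
    exact Nat.div_le_div_right (by omega)
  have h9 : (((j + l) / addOrderOf d : ℕ) : ℝ) ≤ (l / addOrderOf d : ℕ) + 1 := by
    exact_mod_cast h8
  have h10 : 4 * C * √((p : ℝ) ^ K) = 4 * B := by rw [hB]; ring
  rw [h10]
  linarith

/-! ### Pulling the colouring back to ℤ/p^k -/

theorem image_range_min_addOrderOf {n : ℕ} [NeZero n] (a d : ZMod n) (l : ℕ) :
    (range l).image (fun k : ℕ => a + (k : ZMod n) * d) =
      (range (min l (addOrderOf d))).image fun k : ℕ => a + (k : ZMod n) * d := by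
  refine subset_antisymm ?_ (image_subset_image (range_subset_range.2 (min_le_left _ _)))
  intro x hx
  obtain ⟨k, hk, rfl⟩ := mem_image.1 hx
  refine mem_image.2 ⟨k % addOrderOf d, ?_, ?_⟩
  · rw [mem_range] at hk ⊢
    exact lt_min ((Nat.mod_le _ _).trans_lt hk) (Nat.mod_lt _ (addOrderOf_pos d))
  · simp only [← nsmul_eq_mul, mod_addOrderOf_nsmul]

/-- The kernel of the reduction is annihilated by `M`. -/
theorem addOrderOf_le_mul_addOrderOf_castHom {M N : ℕ} [NeZero (M * N)] [NeZero N]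
    (d : ZMod (M * N)) :
    addOrderOf d ≤ M * addOrderOf (ZMod.castHom (dvd_mul_left N M) (ZMod N) d) := by
  have hM : 0 < M := Nat.pos_of_ne_zero fun h => NeZero.ne (M * N) (by simp [h])
  set o := addOrderOf (ZMod.castHom (dvd_mul_left N M) (ZMod N) d) with ho
  refine Nat.le_of_dvd (Nat.mul_pos hM (addOrderOf_pos _)) (addOrderOf_dvd_of_nsmul_eq_zero ?_)
  have h1 : ZMod.castHom (dvd_mul_left N M) (ZMod N) (o • d) = 0 := by
    rw [map_nsmul, ho, addOrderOf_nsmul_eq_zero]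
  rw [← ZMod.natCast_zmod_val (o • d), map_natCast, ZMod.natCast_eq_zero_iff] at h1
  rw [mul_nsmul', ← ZMod.natCast_zmod_val (o • d), nsmul_eq_mul, ← Nat.cast_mul,
    ZMod.natCast_eq_zero_iff]
  exact Nat.mul_dvd_mul_left _ h1

theorem exists_disc_modularAP_le : ∃ C : ℝ, 0 < C ∧ ∀ (p k : ℕ) [NeZero (p ^ k)], p.Prime →
    (disc (modularAP (p ^ k)) : ℝ) ≤ C * √((p : ℝ) ^ (k - k / 3)) := by
  obtain ⟨C, hC0, hC⟩ := exists_coloring_zmod_prime_pow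
  refine ⟨4 + C, by linarith, fun p k _ hp => ?_⟩
  obtain ⟨m, K, hm, hK, hmK⟩ : ∃ m K, k / 3 = m ∧ k - k / 3 = K ∧ m + K = k :=
    ⟨_, _, rfl, rfl, by omega⟩
  have hmK2 : 2 * m ≤ K := by omega
  rw [hK]
  clear hm hK
  subst hmK
  have hp1 : (1 : ℝ) ≤ p := by exact_mod_cast hp.one_lt.le
  have : NeZero (p ^ K) := ⟨(pow_pos hp.pos K).ne'⟩
  obtain ⟨φ, hφ⟩ := hC p K hp
  have hn : p ^ (m + K) = p ^ m * p ^ K := pow_add _ _ _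
  -- The modulus is turned into a literal product so that `ZMod.castHom` applies without transport.
  generalize p ^ (m + K) = n at *
  subst hn
  set ψ := ZMod.castHom (dvd_mul_left (p ^ K) (p ^ m)) (ZMod (p ^ K)) with hψ
  have hle : disc (modularAP (p ^ m * p ^ K)) ≤
      maxImbalance (modularAP (p ^ m * p ^ K)) fun x => φ (ψ x) :=
    ciInf_le (OrderBot.bddBelow _) _
  have hsqrt : (p : ℝ) ^ m ≤ √((p : ℝ) ^ K) := by
    refine Real.le_sqrt_of_sq_le ?_
    rw [← pow_mul]
    exact pow_le_pow_right₀ hp1 (by omega)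
  have hone : (1 : ℝ) ≤ √((p : ℝ) ^ K) := by
    rw [Real.one_le_sqrt]; exact one_le_pow₀ hp1
  have hbound : ∀ A ∈ modularAP (p ^ m * p ^ K),
      ((colorSum (fun x => φ (ψ x)) A).natAbs : ℝ) ≤ (4 + C) * √((p : ℝ) ^ K) := by
    intro A hA
    simp only [modularAP, mem_filter, mem_univ, true_and] at hA
    obtain ⟨a, d, l, rfl⟩ := hA
    have hA' := image_range_min_addOrderOf a d l
    set l' := min l (addOrderOf d) with hl'
    have h1 : ((colorSum (fun x => φ (ψ x))
        ((range l').image fun k : ℕ => a + (k : ZMod (p ^ m * p ^ K)) * d)).natAbs : ℝ) =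
        |∑ s ∈ range l', ((φ (ψ a + s * ψ d) : ℤ) : ℝ)| := by
      rw [natCast_natAbs_colorSum_eq, sum_image]
      · simp
      · intro s hs t ht hst
        simp only [coe_range, Set.mem_Iio] at hs ht
        have h2 : s • d = t • d := by simpa using hst
        exact nsmul_injOn_Iio_addOrderOf (hs.trans_le (min_le_right _ _))
          (ht.trans_le (min_le_right _ _)) h2
    have h2 := hφ (ψ a) (ψ d) l'
    rw [← h1, ← hA'] at h2
    -- A progression without repetition has at most `addOrderOf d` terms, hence its image makes at
    -- most `p ^ m` full turns.
    have h3 : l' / addOrderOf (ψ d) ≤ p ^ m :=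
      Nat.div_le_of_le_mul (((min_le_right _ _).trans
        (addOrderOf_le_mul_addOrderOf_castHom d)).trans_eq (mul_comm _ _))
    have h4 : ((l' / addOrderOf (ψ d) : ℕ) : ℝ) ≤ (p : ℝ) ^ m := by exact_mod_cast h3
    refine le_trans (le_of_eq ?_) (h2.trans (by linarith))
    congr!
  refine (Nat.cast_le.2 hle).trans ?_
  have hsup : maxImbalance (modularAP (p ^ m * p ^ K)) (fun x => φ (ψ x)) ≤
      ⌊(4 + C) * √((p : ℝ) ^ K)⌋₊ :=
    Finset.sup_le fun A hA => Nat.le_floor (hbound A hA)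
  exact (Nat.cast_le.2 hsup).trans (Nat.floor_le (by positivity))

theorem le_disc_modularAP {p k : ℕ} [NeZero (p ^ k)] (hp : p.Prime) (hk : 0 < k) :
    1 / 4 * √((p : ℝ) ^ (k - k / 3)) ≤ (disc (modularAP (p ^ k)) : ℝ) := by
  obtain ⟨χ, hχ⟩ := exists_maxImbalance_eq_disc (modularAP (p ^ k))
  have h := pow_le_sixteen_mul_sq hp hk (χ := χ) (D := disc (modularAP (p ^ k))) fun A hA => by
    rw [← hχ]
    exact le_sup (f := fun A => (colorSum χ A).natAbs) hA
  have h2 : √((p : ℝ) ^ (k - k / 3)) ≤ 4 * (disc (modularAP (p ^ k)) : ℝ) := by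
    rw [Real.sqrt_le_left (by positivity)]
    linarith
  linarith

end

theorem theorem1p2 :
    ∃ C : ℝ, 0 < C ∧
      ∀ (p k n : ℕ) [NeZero n], p.Prime → 0 < k → n = p ^ k →
        ((1 / 4 : ℝ) * (p : ℝ) ^ (((k : ℝ) - ((k / 3 : ℕ) : ℝ)) / 2) ≤ (disc (modularAP n) : ℝ) ∧
          (disc (modularAP n) : ℝ) ≤ C * (p : ℝ) ^ (((k : ℝ) - ((k / 3 : ℕ) : ℝ)) / 2)) ∧
        ((1 / 4 : ℝ) * (n : ℝ) ^ ((1 / 3 : ℝ) + ((k % 3 : ℕ) : ℝ) / (6 * (k : ℝ))) ≤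
            (disc (modularAP n) : ℝ) ∧
          (disc (modularAP n) : ℝ) ≤
            C * (n : ℝ) ^ ((1 / 3 : ℝ) + ((k % 3 : ℕ) : ℝ) / (6 * (k : ℝ)))) := by
  obtain ⟨C, hC0, hC⟩ := exists_disc_modularAP_le
  refine ⟨C, hC0, ?_⟩
  rintro p k n _ hp hk rfl
  have hp0 : (0 : ℝ) < p := by exact_mod_cast hp.pos
  have hk0 : (k : ℝ) ≠ 0 := by exact_mod_cast hk.ne'
  have h1 : (p : ℝ) ^ (((k : ℝ) - ((k / 3 : ℕ) : ℝ)) / 2) = √((p : ℝ) ^ (k - k / 3)) := by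
    rw [Real.sqrt_eq_rpow, ← Real.rpow_natCast, ← Real.rpow_mul hp0.le,
      Nat.cast_sub (Nat.div_le_self k 3)]
    congr 1
    ring
  have h2 : ((p ^ k : ℕ) : ℝ) ^ ((1 / 3 : ℝ) + ((k % 3 : ℕ) : ℝ) / (6 * (k : ℝ))) =
      (p : ℝ) ^ (((k : ℝ) - ((k / 3 : ℕ) : ℝ)) / 2) := by
    have hdiv : (3 : ℝ) * ((k / 3 : ℕ) : ℝ) + ((k % 3 : ℕ) : ℝ) = k := by
      exact_mod_cast Nat.div_add_mod k 3
    rw [Nat.cast_pow, ← Real.rpow_natCast, ← Real.rpow_mul hp0.le]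
    congr 1
    field_simp
    linarith
  rw [h2, h1]
  exact ⟨⟨le_disc_modularAP hp hk, hC p k hp⟩, ⟨le_disc_modularAP hp hk, hC p k hp⟩⟩
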